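/- **Setting.** Let $n\ge 1$ and let $\Omega\subseteq\mathbb R^n$. Let $f$ be a $\nu$-self-concordant barrier for $\Omega$ with $\nu>0$. That is, $\operatorname{dom} f$ is nonempty, open and convex with closure $\Omega$; $f$ is convex and $C^3$ on $\operatorname{dom} f$ and tends to $+\infty$ at every boundary point of $\operatorname{dom} f$; every restriction $\varphi(\tau)=f(x+\tau v)$ satisfies $|\varphi'''|\le 2(\varphi'')^{3/2}$; and $2\nabla f(x)^Tu-u^T\nabla^2f(x)u\le\nu$ for all $x\in\operatorname{dom}f$ and $u\in\mathbb R^n$. Assume $\nabla^2 f\succ0$ on $\operatorname{dom} f$ and write $\|u\|_x=(u^T\nabla^2f(x)u)^{1/2}$. Let $g:\mathbb R^n\to\mathbb R\cup\{+\infty\}$ be proper, lower semicontinuous and convex, and put $\operatorname{dom}F=\operatorname{dom}f\cap\operatorname{dom}g$ and $F(x;t)=f(x)+t^{-1}g(x)$. Assume that for every $t>0$ the function $F(\cdot;t)$ has a minimizer $x^*_t\in\operatorname{dom}F$, and that $x^*$ is a solution of $\min_{x\in\Omega}g(x)$. **Subproblems.** Put $\widehat F(y;t,x)=f(x)+\nabla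 f(x)^T(y-x)+\frac12\|y-x\|_x^2+t^{-1}g(y)$. A $\delta$-solution of the subproblem at $x$ with parameter $t$ is a point $y\in\operatorname{dom}F$ with $\widehat F(y;t,x)\le\inf_{z\in\operatorname{dom}F}\widehat F(z;t,x)+\delta^2/2$. **Algorithm.** Input: $t_0>0$, $\beta\in(0,0.15]$, $\kappa\in(0,1)$, $x^0\in\operatorname{dom}F$, and $\gamma_0>0$ with $\gamma_0\ge F(x^0;t_0)-F(x^*_{t_0};t_0)$. Let $$\omega(s)=s-\ln(1+s),\qquad C(\beta)=\frac{\sqrt\beta-2.581\beta}{2.581+\sqrt\beta},\qquad \sigma_\beta=\frac{C(\beta)}{(1+C(\beta))\sqrt\nu}.$$ *Phase I.* Start with $y^0=x^0$. For $j=0,1,\dots$ compute a $\delta_0^j$-solution $s^j$ of the subproblem at $y^j$ with parameter $t_0$, where $0\le\delta_0^j\le\kappa\zeta_j$ and $\zeta_j=\|s^j-y^j\|_{y^j}$ (in particular $\delta_0^j=\kappa\beta$ is allowed when $\zeta_j\ge\beta$), and set $y^{j+1}=y^j+\frac{1-\kappa}{1+(1-\kappa)\zeta_j}(s^j-y^j)$.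 Stop at the first $j$ with $\omega(\beta)+\sum_{l\le j}\omega((1-\kappa)\zeta_l)\ge\gamma_0$ and set $x_{t_0}=y^{j+1}$. *Phase II.* For $k=0,1,\dots$ set $t_{k+1}=(1\pm\sigma_\beta)t_k$ (either sign at each iteration) and let $x_{t_{k+1}}$ be a $\delta_k$-solution of the subproblem at $x_{t_k}$ with parameter $t_{k+1}$, where $0\le\delta_k\le0.075\beta$. **Theorem.** After $\bar k\ge 0$ iterations of Phase II, $$|g(x_{t_{\bar k}})-g(x^*)|\le\psi(\beta,\nu)\,t_{\bar k},$$ with both objective values finite, where $$\psi(\beta,\nu)=\nu+\sqrt\nu\,\frac{\beta}{1-0.4\sqrt\beta}+\frac{0.4\sqrt\beta}{(1-0.4\sqrt\beta)^2}\left(1.075\beta+0.4\sqrt\beta\right)+0.003\beta^2 .$$ If moreover $t_{k+1}=(1-\sigma_\beta)t_k$ in all these iterations, then an $\varepsilon$-optimal solution is reached in $O\big(\sqrt\nu\log(t_0\psi(\beta,\nu)/\varepsilon)\big)$ Phase II iterations. Precisely, there is a constant $K>0$ depending only on $\beta$ such that, for every $\varepsilon>0$, $$\bar k\ge\max\Big\{0,\Big\lceil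 K\sqrt\nu\,\log\frac{t_0\psi(\beta,\nu)}{\varepsilon}\Big\rceil\Big\}\quad\Longrightarrow\quad|g(x_{t_{\bar k}})-g(x^*)|\le\varepsilon .$$ For $\bar k\ge1$ the same conclusions hold if Phase I is skipped and $x_{t_0}$ is any point of $\operatorname{dom}F$ with $\|x_{t_0}-x^*_{t_0}\|_{x^*_{t_0}}\le\beta$. -/

import Mathlib

open scoped Topology

noncomputable section

namespace ProxPath

/-- `ℝⁿ` with its Euclidean structure. -/
abbrev E (n : ℕ) : Type := EuclideanSpace ℝ (Fin n)

variable {n : ℕ}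

/-- The Hessian form `uᵀ ∇²f(x) v`. The gradient form `∇f(x)ᵀ u` is written `fderiv ℝ f x u`. -/
def hess (f : E n → ℝ) (x u v : E n) : ℝ :=
  fderiv ℝ (fderiv ℝ f) x u v

/-- The local norm `‖u‖_x = (uᵀ ∇²f(x) u)^{1/2}`. -/
def localNorm (f : E n → ℝ) (x u : E n) : ℝ :=
  √(hess f x u u)

/-- `f`, regarded as a function on `dom f = D` (and as `+∞` outside `D`), is a standard
self-concordant function: `D` is a nonempty open convex set, `f` is convex and `C³` on `D`, `f` is
closed, and every restriction `φ(τ) = f (x + τ v)` satisfies `|φ'''(τ)| ≤ 2 φ''(τ)^{3/2}`.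
Since `D` is open, closedness (lower semicontinuity of the extension by `+∞`) says precisely that
`f` tends to `+∞` at every boundary point of `D`. -/
structure IsSelfConcordant (D : Set (E n)) (f : E n → ℝ) : Prop where
  nonempty : D.Nonempty
  isOpen : IsOpen D
  convexOn : ConvexOn ℝ D f
  contDiffOn : ContDiffOn ℝ 3 f D
  closed : ∀ x ∈ frontier D, Filter.Tendsto f (𝓝[D] x) Filter.atTop
  third_le : ∀ x ∈ D, ∀ v : E n, ∀ τ : ℝ, x + τ • v ∈ D →
    |iteratedDeriv 3 (fun s : ℝ => f (x + s • v)) τ| ≤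
      2 * (iteratedDeriv 2 (fun s : ℝ => f (x + s • v)) τ) ^ (3 / 2 : ℝ)

/-- `f` is a `ν`-self-concordant barrier for the set `Ω`: it is standard self-concordant, `Ω` is
the closure of `dom f = D`, and `sup_u {2 ∇f(x)ᵀ u - ‖u‖_x²} ≤ ν` for all `x ∈ D`. -/
structure IsBarrier (Ω D : Set (E n)) (f : E n → ℝ) (ν : ℝ) : Prop where
  selfConcordant : IsSelfConcordant D f
  closure_eq : closure D = Ω
  bound : ∀ x ∈ D, ∀ u : E n, 2 * fderiv ℝ f x u - hess f x u u ≤ ν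

/-- `g : ℝⁿ → ℝ ∪ {+∞}` is proper, lower semicontinuous and convex (its epigraph is convex). -/
structure IsProperLscConvex (g : E n → EReal) : Prop where
  ne_bot : ∀ x, g x ≠ ⊥
  proper : ∃ x, g x ≠ ⊤
  lsc : LowerSemicontinuous g
  convex_epigraph : Convex ℝ {p : E n × ℝ | g p.1 ≤ (p.2 : EReal)}

/-- `dom F = dom f ∩ dom g`. -/
def domF (D : Set (E n)) (g : E n → EReal) : Set (E n) :=
  {x | x ∈ D ∧ g x ≠ ⊤}

/-- `F(x; t) = f(x) + t⁻¹ g(x)`, used only for `x ∈ dom F`, where `g x` is finite. -/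
def F (f : E n → ℝ) (g : E n → EReal) (t : ℝ) (x : E n) : ℝ :=
  f x + t⁻¹ * (g x).toReal

/-- `y` solves the barrier problem: it minimizes `F(·; t)`, which is `+∞` outside `dom F`. -/
def IsCentralPoint (D : Set (E n)) (f : E n → ℝ) (g : E n → EReal) (t : ℝ) (y : E n) : Prop :=
  y ∈ domF D g ∧ ∀ z ∈ domF D g, F f g t y ≤ F f g t z

/-- `y` solves the constrained problem `min {g(x) : x ∈ Ω}`. -/
def IsConstrainedSolution (Ω : Set (E n)) (g : E n → EReal) (y : E n) : Prop :=
  y ∈ Ω ∧ ∀ z ∈ Ω, g y ≤ g z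

/-- The quadratic composite model
`F̂(y; t, x) = f(x) + ∇f(x)ᵀ(y-x) + ½ (y-x)ᵀ∇²f(x)(y-x) + t⁻¹ g(y)`. -/
def model (f : E n → ℝ) (g : E n → EReal) (t : ℝ) (x y : E n) : ℝ :=
  f x + fderiv ℝ f x (y - x) + (1 / 2) * hess f x (y - x) (y - x) + t⁻¹ * (g y).toReal

/-- `y` is a `δ`-solution of the proximal-Newton subproblem `min {F̂(z; t, x) : z ∈ dom F}`:
`y ∈ dom F` and `F̂(y; t, x)` exceeds the optimal value by at most `δ²/2`. If the subproblem has an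
exact solution `x̄`, this says `F̂(y; t, x) - F̂(x̄; t, x) ≤ δ²/2`. -/
def IsDeltaSolution (D : Set (E n)) (f : E n → ℝ) (g : E n → EReal) (t : ℝ) (x : E n) (δ : ℝ)
    (y : E n) : Prop :=
  y ∈ domF D g ∧ ∀ z ∈ domF D g, model f g t x y ≤ model f g t x z + δ ^ 2 / 2

/-- `ω(s) = s - ln(1 + s)`. -/
def omega (s : ℝ) : ℝ := s - Real.log (1 + s)

/-- `C(β) = (√β - 2.581 β) / (2.581 + √β)`. -/
def Cβ (β : ℝ) : ℝ := (√β - 2.581 * β) / (2.581 + √β)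

/-- `σ_β = C(β) / ((1 + C(β)) √ν)`. -/
def sigma (β ν : ℝ) : ℝ := Cβ β / ((1 + Cβ β) * √ν)

/-- The constant `ψ(β, ν)`. -/
def psi (β ν : ℝ) : ℝ :=
  ν + √ν * (β / (1 - 0.4 * √β)) +
    0.4 * √β / (1 - 0.4 * √β) ^ 2 * (1.075 * β + 0.4 * √β) + 0.003 * β ^ 2

/-- `Γ_j = ω(β) + ∑_{l ≤ j} ω((1-κ) ζ_l)` with `ζ_l = ‖s_l - y_l‖_{y_l}`. -/
def Gam (f : E n → ℝ) (β κ : ℝ) (y s : ℕ → E n) (j : ℕ) : ℝ :=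
  omega β + ∑ l ∈ Finset.range (j + 1), omega ((1 - κ) * localNorm f (y l) (s l - y l))

/-- `out` is an output of Phase I (inexact damped proximal-Newton method at the fixed parameter
`t₀`, started at `x₀`). At iteration `j` a `δ_j`-solution `s_j` of the subproblem at `y_j` is
computed, `0 ≤ δ_j ≤ κ ζ_j` with `ζ_j = ‖s_j - y_j‖_{y_j}` (in particular `δ_j = κ β` is allowed
as long as `ζ_j ≥ β`), and `y_{j+1} = y_j + α_j (s_j - y_j)` with
`α_j = (1-κ) / (1 + (1-κ) ζ_j)`. Phase I ends at the first `J` with `Γ_J ≥ γ₀` and returns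
`y_{J+1}`. -/
def IsPhaseIOutput (D : Set (E n)) (f : E n → ℝ) (g : E n → EReal) (β κ γ₀ t₀ : ℝ)
    (x₀ out : E n) : Prop :=
  ∃ (J : ℕ) (y s : ℕ → E n),
    y 0 = x₀ ∧
    (∀ j ≤ J,
      (∃ δ : ℝ, 0 ≤ δ ∧ δ ≤ κ * localNorm f (y j) (s j - y j) ∧
        IsDeltaSolution D f g t₀ (y j) δ (s j)) ∧
      y (j + 1) =
        y j + ((1 - κ) / (1 + (1 - κ) * localNorm f (y j) (s j - y j))) • (s j - y j)) ∧
    (∀ j < J, Gam f β κ y s j < γ₀) ∧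
    γ₀ ≤ Gam f β κ y s J ∧
    out = y (J + 1)

/-- The first `kbar` iterations of Phase II: `t_{k+1} = (1 ± σ_β) t_k`, and `x_{k+1}` is a
`δ_k`-solution of the subproblem at `x_k` with parameter `t_{k+1}`, where `0 ≤ δ_k ≤ 0.075 β`. -/
def IsPhaseIIRun (D : Set (E n)) (f : E n → ℝ) (g : E n → EReal) (β ν : ℝ)
    (kbar : ℕ) (t : ℕ → ℝ) (x : ℕ → E n) : Prop :=
  ∀ k < kbar,
    (t (k + 1) = (1 - sigma β ν) * t k ∨ t (k + 1) = (1 + sigma β ν) * t k) ∧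
    ∃ δ : ℝ, 0 ≤ δ ∧ δ ≤ 0.075 * β ∧ IsDeltaSolution D f g (t (k + 1)) (x k) δ (x (k + 1))

end ProxPath

end

/-! Write `b = xc t` for the central point. The error splits as `g x - g xs = (g x - g b) + (g b - g
xs)` and is nonnegative because `xs` minimizes `g` over `Ω`. The second bracket is at most `ν t`:
optimality of `b` bounds it by `t ∇f(b)ᵀ(xs - b)`, and a barrier gradient paired with a direction
into `Ω` is at most `ν` (`IsBarrier.central_gap_le`). The first bracket is at most `(ψ - ν) t`
because of the invariant that each iterate lies within `β` of its central point, in the local norm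
there.

Phase I establishes the invariant. Each damped step lowers `F` by `ω((1-κ)ζ)`, so the stopping rule
leaves a gap of at most `ω(β)`, and that gap dominates `ω` of the distance to `b`.

Phase II preserves it. The factor `1 ± σ_β` moves the central point by at most `C(β)`
(`central_path_dist`), so the old iterate is within `√β / 2.581` of the new central point
(`warm_start`), and one inexact Newton step contracts this to `β` (`newton_step_bounds`). The
inexact solution is compared with the central point itself, so no exact subproblem minimizer is
needed.

Everything rests on the classical self-concordance estimates along segments. They need the
third-derivative bound for mixed arguments with the same constant, which is Banach's theorem on
symmetric trilinear forms. The complexity bound follows from `(1 - σ)^k ≤ exp(-kσ)`, where `σ < 1`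
because a nondegenerate barrier has `ν ≥ 1` (`IsBarrier.one_le`). -/

namespace ProxPath

/-! ### Bilinear and trilinear forms -/

section Forms

variable {V : Type*} [NormedAddCommGroup V] [NormedSpace ℝ V]

/-- Polarization: for `H`-unit vectors, `4 B u v` is the difference of the diagonal values at `u +
v` and `u - v`, whose `H`-squares add up to 4. Homogeneity gives the rest. -/
theorem abs_bilin_le_of_abs_diag_le {B H : V →L[ℝ] V →L[ℝ] ℝ} {c : ℝ}
    (hB : ∀ u v, B u v = B v u) (hpos : ∀ u, u ≠ 0 → 0 < H u u)
    (hH : ∀ u v, H u v = H v u) (hBH : ∀ u, |B u u| ≤ c * H u u) (u v : V) :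
    |B u v| ≤ c * (√(H u u) * √(H v v)) := by
  have key : ∀ u v : V, H u u = 1 → H v v = 1 → |B u v| ≤ c := by
    intro u v hu hv
    have h1 := abs_le.1 (hBH (u + v))
    have h2 := abs_le.1 (hBH (u - v))
    simp only [map_add, map_sub, add_apply, sub_apply, hB v u, hH v u, hu, hv] at h1 h2
    rw [abs_le]
    constructor <;> linarith [h1.1, h1.2, h2.1, h2.2]
  by_cases hu : u = 0
  · simp [hu]
  by_cases hv : v = 0
  · simp [hv]
  have hu' := Real.sqrt_pos.2 (hpos u hu)
  have hv' := Real.sqrt_pos.2 (hpos v hv)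
  have hsu := Real.sq_sqrt (hpos u hu).le
  have hsv := Real.sq_sqrt (hpos v hv).le
  have := key ((√(H u u))⁻¹ • u) ((√(H v v))⁻¹ • v)
    (by simp only [map_smul, smul_apply, smul_eq_mul]; field_simp; exact hsu.symm)
    (by simp only [map_smul, smul_apply, smul_eq_mul]; field_simp; exact hsv.symm)
  simp only [map_smul, smul_apply, smul_eq_mul, abs_mul, abs_inv,
    abs_of_pos hu', abs_of_pos hv'] at this
  field_simp at this
  linarith

theorem abs_inner_le {H : V →L[ℝ] V →L[ℝ] ℝ} (hpos : ∀ u, u ≠ 0 → 0 < H u u)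
    (hH : ∀ u v, H u v = H v u) (u v : V) : |H u v| ≤ √(H u u) * √(H v v) := by
  have := abs_bilin_le_of_abs_diag_le (c := 1) hH hpos hH (fun u => by
    rw [one_mul, abs_of_nonneg]
    by_cases h : u = 0
    · simp [h]
    · exact (hpos u h).le) u v
  simpa using this

theorem sqrt_form_add_le {H : V →L[ℝ] V →L[ℝ] ℝ} (hpos : ∀ u, u ≠ 0 → 0 < H u u)
    (hH : ∀ u v, H u v = H v u) (u v : V) :
    √(H (u + v) (u + v)) ≤ √(H u u) + √(H v v) := by
  have hn : ∀ u, 0 ≤ H u u := fun u => by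
    by_cases h : u = 0
    · simp [h]
    · exact (hpos u h).le
  refine Real.sqrt_le_iff.2 ⟨by positivity, ?_⟩
  have h := (abs_le.1 (abs_inner_le hpos hH u v)).2
  simp only [map_add, add_apply, hH v u]
  nlinarith [Real.sq_sqrt (hn u), Real.sq_sqrt (hn v)]

/-- Riesz-type interpolation formula expressing a mixed value of a binary cubic form as a convex
combination of three diagonal values. -/
theorem cubic_interpolation (a b d e c s k : ℝ) (hk : k ^ 2 = 3) :
    (c ^ 2 + s ^ 2) ^ 2 * ((c ^ 3 - 3 * c * s ^ 2) * a + (3 * c ^ 2 * s - s ^ 3) * b) =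
      ((fun p q : ℝ => (3 * p ^ 2 - q ^ 2) ^ 2 / 9 *
        (p ^ 3 * a + 3 * p ^ 2 * q * b + 3 * p * q ^ 2 * d + q ^ 3 * e)) c s) +
      ((fun p q : ℝ => (3 * p ^ 2 - q ^ 2) ^ 2 / 9 *
        (p ^ 3 * a + 3 * p ^ 2 * q * b + 3 * p * q ^ 2 * d + q ^ 3 * e))
          (-c / 2 - k / 2 * s) (-s / 2 + k / 2 * c)) +
      ((fun p q : ℝ => (3 * p ^ 2 - q ^ 2) ^ 2 / 9 *
        (p ^ 3 * a + 3 * p ^ 2 * q * b + 3 * p * q ^ 2 * d + q ^ 3 * e))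
          (-c / 2 + k / 2 * s) (-s / 2 - k / 2 * c)) := by
  have h4 : k ^ 4 = 9 := by linear_combination (k ^ 2 + 3) * hk
  have h6 : k ^ 6 = 27 := by linear_combination (k ^ 4 + 3 * k ^ 2 + 9) * hk
  ring_nf
  simp only [hk, h4, h6]
  ring

/-- Banach's theorem for a symmetric trilinear form bounded by a Euclidean norm on the diagonal. -/
theorem abs_trilin_le_of_abs_diag_le {T : V →L[ℝ] V →L[ℝ] V →L[ℝ] ℝ} {H : V →L[ℝ] V →L[ℝ] ℝ}
    {M : ℝ} (hM : 0 ≤ M)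
    (hT₁ : ∀ u v w, T u v w = T v u w) (hT₂ : ∀ u v w, T u v w = T u w v)
    (hpos : ∀ u, u ≠ 0 → 0 < H u u) (hH : ∀ u v, H u v = H v u)
    (hTH : ∀ u, |T u u u| ≤ M * √(H u u) ^ 3) (u v : V) :
    |T u v v| ≤ M * (√(H u u) * H v v) := by
  have key : ∀ u v : V, H u u = 1 → H v v = 1 → |T u v v| ≤ M := by
    intro u v hu hv
    have hcs := abs_inner_le hpos hH u v
    rw [hu, hv] at hcs
    simp only [Real.sqrt_one, mul_one] at hcs
    obtain ⟨hl, hr⟩ := abs_le.1 hcs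
    obtain ⟨w, hw1, hw2, hw3⟩ : ∃ w, H v w = 0 ∧ H w w ≤ 1 ∧
        u = Real.cos (Real.arccos (H u v)) • v + Real.sin (Real.arccos (H u v)) • w := by
      rw [Real.cos_arccos hl hr, Real.sin_arccos]
      have hz : H (u - H u v • v) (u - H u v • v) = 1 - H u v ^ 2 := by
        simp only [map_sub, map_smul, sub_apply, smul_apply, smul_eq_mul, hu, hv, hH v u]
        ring
      -- If `u = ±v` there may be no unit vector orthogonal to `v`; then `w = 0`, which is why only
      -- `H w w ≤ 1` is claimed.
      by_cases h : 1 - H u v ^ 2 = 0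
      · refine ⟨0, by simp, by simp, ?_⟩
        have : u - H u v • v = 0 := by
          by_contra hne
          have := hpos _ hne
          rw [hz, h] at this
          exact lt_irrefl _ this
        rw [smul_zero, add_zero]
        exact sub_eq_zero.1 this
      · have hp : 0 < 1 - H u v ^ 2 := lt_of_le_of_ne (by nlinarith) (Ne.symm h)
        have hq := Real.sqrt_pos.2 hp
        refine ⟨(√(1 - H u v ^ 2))⁻¹ • (u - H u v • v), ?_, ?_, ?_⟩
        · simp only [map_sub, map_smul, smul_eq_mul, hv, hH v u]
          ring
        · rw [map_smul, map_smul, smul_apply, hz]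
          simp only [smul_eq_mul]
          rw [← mul_assoc, ← mul_inv, Real.mul_self_sqrt hp.le, inv_mul_cancel₀ hp.ne']
        · rw [smul_inv_smul₀ hq.ne']
          abel
    -- Trisecting the angle between `u` and `v` turns `T u v v` into an average of diagonal values
    -- at the angles `θ` and `θ ± 2π/3`, with nonnegative weights of sum one.
    set θ := Real.arccos (H u v) / 3 with hθ
    have h3 : Real.arccos (H u v) = 3 * θ := by rw [hθ]; ring
    rw [h3, Real.cos_three_mul, Real.sin_three_mul] at hw3
    set c := Real.cos θ
    set s := Real.sin θ
    have hcs1 : c ^ 2 + s ^ 2 = 1 := Real.cos_sq_add_sin_sq θ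
    have hbd : ∀ p q : ℝ, p ^ 2 + q ^ 2 = 1 →
        |p ^ 3 * T v v v + 3 * p ^ 2 * q * T v v w + 3 * p * q ^ 2 * T v w w + q ^ 3 * T w w w|
          ≤ M := by
      intro p q hpq
      have h1 := hTH (p • v + q • w)
      have e1 : T (p • v + q • w) (p • v + q • w) (p • v + q • w) =
          p ^ 3 * T v v v + 3 * p ^ 2 * q * T v v w + 3 * p * q ^ 2 * T v w w
            + q ^ 3 * T w w w := by
        simp only [map_add, map_smul, add_apply, smul_apply, smul_eq_mul]
        rw [hT₁ w v v, hT₂ v w v, hT₂ w w v, hT₁ w v w]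
        ring
      have e2 : H (p • v + q • w) (p • v + q • w) ≤ 1 := by
        simp only [map_add, map_smul, add_apply, smul_apply, smul_eq_mul, hv,
          hH w v, hw1]
        nlinarith [sq_nonneg q]
      rw [e1] at h1
      refine h1.trans (mul_le_of_le_one_right hM ?_)
      exact pow_le_one₀ (Real.sqrt_nonneg _) (Real.sqrt_le_one.2 e2)
    have hk : (√3 : ℝ) ^ 2 = 3 := Real.sq_sqrt (by norm_num)
    have hid := cubic_interpolation (T v v v) (T v v w) (T v w w) (T w w w) c s (√3) hk
    have hu3 : T u v v = (c ^ 2 + s ^ 2) ^ 2 *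
        ((c ^ 3 - 3 * c * s ^ 2) * T v v v + (3 * c ^ 2 * s - s ^ 3) * T v v w) := by
      rw [hw3]
      simp only [map_add, map_smul, add_apply, smul_apply, smul_eq_mul]
      rw [hT₁ w v v, hT₂ v w v, hcs1]
      have hs2 : s ^ 2 = 1 - c ^ 2 := by linarith
      have hs3 : s ^ 3 = s * (1 - c ^ 2) := by rw [← hs2]; ring
      rw [hs2, hs3]
      ring
    rw [hu3, hid]
    have b1 := abs_le.1 (hbd c s hcs1)
    have b2 := abs_le.1 (hbd (-c / 2 - √3 / 2 * s) (-s / 2 + √3 / 2 * c) (by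
      linear_combination (1 / 4 * s ^ 2 + 1 / 4 * c ^ 2) * hk + hcs1))
    have b3 := abs_le.1 (hbd (-c / 2 + √3 / 2 * s) (-s / 2 - √3 / 2 * c) (by
      linear_combination (1 / 4 * s ^ 2 + 1 / 4 * c ^ 2) * hk + hcs1))
    have hw : (3 * c ^ 2 - s ^ 2) ^ 2 / 9 +
        (3 * (-c / 2 - √3 / 2 * s) ^ 2 - (-s / 2 + √3 / 2 * c) ^ 2) ^ 2 / 9 +
        (3 * (-c / 2 + √3 / 2 * s) ^ 2 - (-s / 2 - √3 / 2 * c) ^ 2) ^ 2 / 9 = 1 := by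
      have h4 : (√3 : ℝ) ^ 4 = 9 := by linear_combination ((√3 : ℝ) ^ 2 + 3) * hk
      have : (c ^ 2 + s ^ 2) ^ 2 = 1 := by rw [hcs1]; norm_num
      rw [← this]
      ring_nf
      simp only [hk, h4]
      ring
    beta_reduce
    set w1 := (3 * c ^ 2 - s ^ 2) ^ 2 / 9
    set w2 := (3 * (-c / 2 - √3 / 2 * s) ^ 2 - (-s / 2 + √3 / 2 * c) ^ 2) ^ 2 / 9
    set w3 := (3 * (-c / 2 + √3 / 2 * s) ^ 2 - (-s / 2 - √3 / 2 * c) ^ 2) ^ 2 / 9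
    have n1 : 0 ≤ w1 := by positivity
    have n2 : 0 ≤ w2 := by positivity
    have n3 : 0 ≤ w3 := by positivity
    have hMw : M = w1 * M + w2 * M + w3 * M := by rw [← add_mul, ← add_mul, hw, one_mul]
    rw [abs_le]
    constructor
    · linarith [mul_le_mul_of_nonneg_left b1.1 n1, mul_le_mul_of_nonneg_left b2.1 n2,
        mul_le_mul_of_nonneg_left b3.1 n3]
    · linarith [mul_le_mul_of_nonneg_left b1.2 n1, mul_le_mul_of_nonneg_left b2.2 n2,
        mul_le_mul_of_nonneg_left b3.2 n3]
  by_cases hu : u = 0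
  · simp [hu]
  by_cases hv : v = 0
  · simp [hv]
  have hu' := Real.sqrt_pos.2 (hpos u hu)
  have hv' := Real.sqrt_pos.2 (hpos v hv)
  have hsu := Real.sq_sqrt (hpos u hu).le
  have hsv := Real.sq_sqrt (hpos v hv).le
  have := key ((√(H u u))⁻¹ • u) ((√(H v v))⁻¹ • v)
    (by simp only [map_smul, smul_apply, smul_eq_mul]; field_simp; exact hsu.symm)
    (by simp only [map_smul, smul_apply, smul_eq_mul]; field_simp; exact hsv.symm)
  simp only [map_smul, smul_apply, smul_eq_mul, abs_mul, abs_inv,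
    abs_of_pos hu', abs_of_pos hv'] at this
  field_simp at this
  rw [hsv] at this
  linarith

end Forms

/-! ### Monotonicity from derivatives -/

/-- Stands in for integration: each integral estimate below is monotonicity of an explicit
primitive. -/
theorem le_of_hasDerivAt_nonneg {φ φ' : ℝ → ℝ} {a b : ℝ} (hab : a ≤ b)
    (h : ∀ s ∈ Set.Icc a b, HasDerivAt φ (φ' s) s) (h0 : ∀ s ∈ Set.Icc a b, 0 ≤ φ' s) :
    φ a ≤ φ b := by
  have : MonotoneOn φ (Set.Icc a b) := by
    refine monotoneOn_of_deriv_nonneg (convex_Icc a b)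
      (fun s hs => (h s hs).continuousAt.continuousWithinAt) (fun s hs => ?_) (fun s hs => ?_)
    · exact (h s (interior_subset hs)).differentiableAt.differentiableWithinAt
    · rw [(h s (interior_subset hs)).deriv]
      exact h0 s (interior_subset hs)
  exact this (Set.left_mem_Icc.2 hab) (Set.right_mem_Icc.2 hab) hab

end ProxPath

namespace ProxPath

variable {n : ℕ} {D : Set (E n)} {f : E n → ℝ}

/-! ### Derivatives of a self-concordant function along lines -/

/-- The third derivative `D³f(x)[u, v, w]`. -/
noncomputable def third (f : E n → ℝ) (x u v w : E n) : ℝ :=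
  fderiv ℝ (fderiv ℝ (fderiv ℝ f)) x u v w

/-- A self-concordant function with positive definite Hessian. -/
structure IsNondegenerate (D : Set (E n)) (f : E n → ℝ) : Prop
    extends IsSelfConcordant D f where
  pos : ∀ x ∈ D, ∀ u : E n, u ≠ 0 → 0 < hess f x u u

theorem hasDerivAt_line (x u : E n) (s : ℝ) : HasDerivAt (fun s : ℝ => x + s • u) u s := by
  simpa using ((hasDerivAt_id s).smul_const u).const_add x

namespace IsNondegenerate

theorem contDiffAt (hf : IsNondegenerate D f) {x : E n} (hx : x ∈ D) : ContDiffAt ℝ 3 f x :=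
  hf.contDiffOn.contDiffAt (hf.isOpen.mem_nhds hx)

theorem contDiffAt_fderiv (hf : IsNondegenerate D f) {x : E n} (hx : x ∈ D) :
    ContDiffAt ℝ 2 (fderiv ℝ f) x :=
  (hf.contDiffAt hx).fderiv_right (by norm_num)

theorem contDiffAt_fderiv_fderiv (hf : IsNondegenerate D f) {x : E n} (hx : x ∈ D) :
    ContDiffAt ℝ 1 (fderiv ℝ (fderiv ℝ f)) x :=
  (hf.contDiffAt_fderiv hx).fderiv_right (by norm_num)

theorem hasDerivAt_apply (hf : IsNondegenerate D f) {x u : E n} {s : ℝ} (hx : x + s • u ∈ D) :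
    HasDerivAt (fun s : ℝ => f (x + s • u)) (fderiv ℝ f (x + s • u) u) s :=
  ((hf.contDiffAt hx).differentiableAt (by norm_num)).hasFDerivAt.comp_hasDerivAt s
    (hasDerivAt_line x u s)

theorem hasDerivAt_grad (hf : IsNondegenerate D f) {x u : E n} {s : ℝ} (hx : x + s • u ∈ D)
    (v : E n) :
    HasDerivAt (fun s : ℝ => fderiv ℝ f (x + s • u) v) (hess f (x + s • u) u v) s := by
  have := ((hf.contDiffAt_fderiv hx).differentiableAt (by norm_num)).hasFDerivAt.comp_hasDerivAt s
    (hasDerivAt_line x u s)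
  exact (ContinuousLinearMap.apply ℝ ℝ v).hasFDerivAt.comp_hasDerivAt s this

theorem hasDerivAt_hess (hf : IsNondegenerate D f) {x u : E n} {s : ℝ} (hx : x + s • u ∈ D)
    (v w : E n) :
    HasDerivAt (fun s : ℝ => hess f (x + s • u) v w) (third f (x + s • u) u v w) s := by
  have := ((hf.contDiffAt_fderiv_fderiv hx).differentiableAt
    (by norm_num)).hasFDerivAt.comp_hasDerivAt s (hasDerivAt_line x u s)
  have h2 := (ContinuousLinearMap.apply ℝ (E n →L[ℝ] ℝ) v).hasFDerivAt.comp_hasDerivAt s this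
  exact (ContinuousLinearMap.apply ℝ ℝ w).hasFDerivAt.comp_hasDerivAt s h2

theorem hess_symm (hf : IsNondegenerate D f) {x : E n} (hx : x ∈ D) (u v : E n) :
    hess f x u v = hess f x v u :=
  (hf.contDiffAt hx).isSymmSndFDerivAt (by simp; norm_num) u v

theorem third_symm_left (hf : IsNondegenerate D f) {x : E n} (hx : x ∈ D) (u v w : E n) :
    third f x u v w = third f x v u w := by
  have := (hf.contDiffAt_fderiv hx).isSymmSndFDerivAt (by simp) u v
  exact DFunLike.congr_fun this w

theorem eventually_line_mem (hf : IsNondegenerate D f) {x u : E n} {s : ℝ}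
    (hx : x + s • u ∈ D) : ∀ᶠ τ in 𝓝 s, x + τ • u ∈ D :=
  (hasDerivAt_line x u s).continuousAt.eventually (hf.isOpen.mem_nhds hx)

/-- Differentiate the symmetry of the Hessian along the line in direction `u`. -/
theorem third_symm_right (hf : IsNondegenerate D f) {x : E n} (hx : x ∈ D) (u v w : E n) :
    third f x u v w = third f x u w v := by
  have hx0 : x + (0 : ℝ) • u ∈ D := by simpa using hx
  have h1 := hf.hasDerivAt_hess hx0 v w
  have h2 := hf.hasDerivAt_hess hx0 w v
  have h3 : (fun s : ℝ => hess f (x + s • u) v w) =ᶠ[𝓝 0] fun s : ℝ => hess f (x + s • u) w v := by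
    filter_upwards [hf.eventually_line_mem hx0] with s hs using hf.hess_symm hs v w
  simpa using h1.unique (h2.congr_of_eventuallyEq h3)

theorem deriv_line_eventuallyEq (hf : IsNondegenerate D f) {x u : E n} {s : ℝ}
    (hx : x + s • u ∈ D) :
    deriv (fun s : ℝ => f (x + s • u)) =ᶠ[𝓝 s] fun s => fderiv ℝ f (x + s • u) u := by
  filter_upwards [hf.eventually_line_mem hx] with τ hτ using (hf.hasDerivAt_apply hτ).deriv

theorem iteratedDeriv_two_eventuallyEq (hf : IsNondegenerate D f) {x u : E n} {s : ℝ}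
    (hx : x + s • u ∈ D) :
    iteratedDeriv 2 (fun s : ℝ => f (x + s • u)) =ᶠ[𝓝 s] fun s => hess f (x + s • u) u u := by
  filter_upwards [hf.eventually_line_mem hx] with τ hτ
  rw [iteratedDeriv_succ, iteratedDeriv_one, (hf.deriv_line_eventuallyEq hτ).deriv_eq]
  exact (hf.hasDerivAt_grad hτ u).deriv

theorem iteratedDeriv_three (hf : IsNondegenerate D f) {x u : E n} {s : ℝ}
    (hx : x + s • u ∈ D) :
    iteratedDeriv 3 (fun s : ℝ => f (x + s • u)) s = third f (x + s • u) u u u := by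
  rw [iteratedDeriv_succ, (hf.iteratedDeriv_two_eventuallyEq hx).deriv_eq]
  exact (hf.hasDerivAt_hess hx u u).deriv

theorem hess_nonneg (hf : IsNondegenerate D f) {x : E n} (hx : x ∈ D) (u : E n) :
    0 ≤ hess f x u u := by
  by_cases h : u = 0
  · simp [h, hess]
  · exact (hf.pos x hx u h).le

theorem localNorm_sq (hf : IsNondegenerate D f) {x : E n} (hx : x ∈ D) (u : E n) :
    localNorm f x u ^ 2 = hess f x u u :=
  Real.sq_sqrt (hf.hess_nonneg hx u)

theorem localNorm_pos (hf : IsNondegenerate D f) {x : E n} (hx : x ∈ D) {u : E n} (hu : u ≠ 0) :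
    0 < localNorm f x u :=
  Real.sqrt_pos.2 (hf.pos x hx u hu)

theorem abs_third_diag_le (hf : IsNondegenerate D f) {x : E n} (hx : x ∈ D) (u : E n) :
    |third f x u u u| ≤ 2 * localNorm f x u ^ 3 := by
  have hx0 : x + (0 : ℝ) • u ∈ D := by simpa using hx
  have h := hf.third_le x hx u 0 hx0
  rw [hf.iteratedDeriv_three hx0, (hf.iteratedDeriv_two_eventuallyEq hx0).eq_of_nhds] at h
  simp only [zero_smul, add_zero] at h
  convert h using 2
  rw [localNorm, Real.sqrt_eq_rpow, ← Real.rpow_natCast, ← Real.rpow_mul (hf.hess_nonneg hx u)]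
  norm_num

theorem abs_third_le (hf : IsNondegenerate D f) {x : E n} (hx : x ∈ D) (u v : E n) :
    |third f x u v v| ≤ 2 * (localNorm f x u * hess f x v v) :=
  abs_trilin_le_of_abs_diag_le (T := fderiv ℝ (fderiv ℝ (fderiv ℝ f)) x)
    (H := fderiv ℝ (fderiv ℝ f) x) (by norm_num) (hf.third_symm_left hx) (hf.third_symm_right hx)
    (hf.pos x hx) (hf.hess_symm hx) (hf.abs_third_diag_le hx) u v

theorem localNorm_add_le (hf : IsNondegenerate D f) {x : E n} (hx : x ∈ D) (u v : E n) :
    localNorm f x (u + v) ≤ localNorm f x u + localNorm f x v :=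
  sqrt_form_add_le (H := fderiv ℝ (fderiv ℝ f) x) (hf.pos x hx) (hf.hess_symm hx) u v

end IsNondegenerate

theorem localNorm_nonneg (f : E n → ℝ) (x u : E n) : 0 ≤ localNorm f x u :=
  Real.sqrt_nonneg _

theorem hess_smul_smul (f : E n → ℝ) (x u : E n) (c : ℝ) :
    hess f x (c • u) (c • u) = c ^ 2 * hess f x u u := by
  simp only [hess, map_smul, smul_apply, smul_eq_mul]
  ring

theorem localNorm_smul (f : E n → ℝ) (x u : E n) {c : ℝ} (hc : 0 ≤ c) :
    localNorm f x (c • u) = c * localNorm f x u := by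
  rw [localNorm, hess_smul_smul, Real.sqrt_mul (sq_nonneg c), Real.sqrt_sq hc, localNorm]

theorem localNorm_neg (f : E n → ℝ) (x u : E n) : localNorm f x (-u) = localNorm f x u := by
  simp [localNorm, hess]

theorem localNorm_sub_comm (f : E n → ℝ) (x u v : E n) :
    localNorm f x (u - v) = localNorm f x (v - u) := by
  rw [← localNorm_neg, neg_sub]

theorem localNorm_zero (f : E n → ℝ) (x : E n) : localNorm f x 0 = 0 := by
  simp [localNorm, hess]

/-! ### Comparison of local norms, gradients and values along a segment -/

namespace IsNondegenerate

theorem line_mem (hf : IsNondegenerate D f) {x u : E n} (hx : x ∈ D) (hxu : x + u ∈ D) {s : ℝ}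
    (hs : s ∈ Set.Icc (0 : ℝ) 1) : x + s • u ∈ D :=
  hf.convexOn.1.add_smul_mem hx hxu hs

/-- Self-concordance in its most usable form: `(φ'')^{-1/2}` has derivative `-φ''' / (2 φ''^{3/2})`,
so it is 1-Lipschitz along the line. -/
theorem hasDerivAt_inv_localNorm (hf : IsNondegenerate D f) {x u : E n} (hu : u ≠ 0) {s : ℝ}
    (hx : x + s • u ∈ D) :
    ∃ q, |q| ≤ 1 ∧ HasDerivAt (fun s : ℝ => (localNorm f (x + s • u) u)⁻¹) q s := by
  have hp := hf.localNorm_pos hx hu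
  have h := ((hf.hasDerivAt_hess hx u u).sqrt (hf.pos _ hx u hu).ne').inv hp.ne'
  refine ⟨_, ?_, h⟩
  have hb := hf.abs_third_diag_le hx u
  change |-(third f (x + s • u) u u u / (2 * localNorm f (x + s • u) u)) /
    localNorm f (x + s • u) u ^ 2| ≤ 1
  rw [abs_div, abs_neg, abs_div, abs_of_pos (by positivity : 0 < 2 * localNorm f (x + s • u) u),
    abs_of_pos (by positivity : 0 < localNorm f (x + s • u) u ^ 2), div_div, div_le_one
    (by positivity)]
  linarith

theorem abs_inv_localNorm_sub_le (hf : IsNondegenerate D f) {x u : E n} (hu : u ≠ 0)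
    (hx : x ∈ D) (hxu : x + u ∈ D) {s : ℝ} (hs : s ∈ Set.Icc (0 : ℝ) 1) :
    |(localNorm f (x + s • u) u)⁻¹ - (localNorm f x u)⁻¹| ≤ s := by
  have hmem : ∀ τ ∈ Set.Icc 0 s, x + τ • u ∈ D := fun τ hτ =>
    hf.line_mem hx hxu ⟨hτ.1, hτ.2.trans hs.2⟩
  have hd : ∀ τ : ℝ, ∃ q : ℝ, τ ∈ Set.Icc 0 s → |q| ≤ 1 ∧
      HasDerivAt (fun s : ℝ => (localNorm f (x + s • u) u)⁻¹) q τ := by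
    intro τ
    by_cases hτ : τ ∈ Set.Icc 0 s
    · obtain ⟨q, h⟩ := hf.hasDerivAt_inv_localNorm hu (hmem τ hτ)
      exact ⟨q, fun _ => h⟩
    -- Dummy value off the segment, so that `choose` yields a total function.
    · exact ⟨0, fun h => absurd h hτ⟩
  choose q hq using hd
  have h1 := le_of_hasDerivAt_nonneg hs.1
    (fun τ hτ => (hq τ hτ).2.add (hasDerivAt_id τ))
    (fun τ hτ => by linarith [(abs_le.1 (hq τ hτ).1).1])
  have h2 := le_of_hasDerivAt_nonneg hs.1
    (fun τ hτ => (hasDerivAt_id τ).sub (hq τ hτ).2)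
    (fun τ hτ => by linarith [(abs_le.1 (hq τ hτ).1).2])
  simp only [Pi.add_apply, Pi.sub_apply, id, zero_smul, add_zero] at h1 h2
  rw [abs_le]
  constructor <;> linarith

theorem localNorm_line_le (hf : IsNondegenerate D f) {x u : E n} (hx : x ∈ D) (hxu : x + u ∈ D)
    {s : ℝ} (hs : s ∈ Set.Icc (0 : ℝ) 1) (hr : s * localNorm f x u < 1) :
    localNorm f (x + s • u) u ≤ localNorm f x u / (1 - s * localNorm f x u) := by
  by_cases hu : u = 0
  · simp [hu, localNorm_zero]
  have h := (abs_le.1 (hf.abs_inv_localNorm_sub_le hu hx hxu hs)).1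
  have hp := hf.localNorm_pos hx hu
  have hp' := hf.localNorm_pos (hf.line_mem hx hxu hs) hu
  have h2 : (1 - s * localNorm f x u) / localNorm f x u ≤ (localNorm f (x + s • u) u)⁻¹ := by
    rw [sub_div, mul_div_assoc, div_self hp.ne', one_div]
    linarith
  have h3 : 0 < (1 - s * localNorm f x u) / localNorm f x u := div_pos (by linarith) hp
  have := inv_anti₀ h3 h2
  rwa [inv_inv, inv_div] at this

theorem le_localNorm_line (hf : IsNondegenerate D f) {x u : E n} (hx : x ∈ D) (hxu : x + u ∈ D)
    {s : ℝ} (hs : s ∈ Set.Icc (0 : ℝ) 1) :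
    localNorm f x u / (1 + s * localNorm f x u) ≤ localNorm f (x + s • u) u := by
  by_cases hu : u = 0
  · simp [hu, localNorm_zero]
  have h := (abs_le.1 (hf.abs_inv_localNorm_sub_le hu hx hxu hs)).2
  have hp := hf.localNorm_pos hx hu
  have hp' := hf.localNorm_pos (hf.line_mem hx hxu hs) hu
  have h2 : (localNorm f (x + s • u) u)⁻¹ ≤ (1 + s * localNorm f x u) / localNorm f x u := by
    rw [add_div, mul_div_assoc, div_self hp.ne', one_div]
    linarith
  have := inv_anti₀ (inv_pos.2 hp') h2
  rwa [inv_inv, inv_div] at this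

/-- A Grönwall argument: `h(τ) = hess f (x + τ • u) v v` satisfies `|h'| ≤ 2r/(1 - τr) · h`, so
`h/(1 - τr)²` increases and `h · (1 - τr)²` decreases. -/
theorem hess_line_bounds (hf : IsNondegenerate D f) {x u : E n} (hx : x ∈ D) (hxu : x + u ∈ D)
    {s : ℝ} (hs : s ∈ Set.Icc (0 : ℝ) 1) (hr : localNorm f x u < 1) (v : E n) :
    (1 - s * localNorm f x u) ^ 2 * hess f x v v ≤ hess f (x + s • u) v v ∧
      (1 - s * localNorm f x u) ^ 2 * hess f (x + s • u) v v ≤ hess f x v v := by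
  set r := localNorm f x u with hrdef
  have hr0 : 0 ≤ r := localNorm_nonneg _ _ _
  have hmem : ∀ τ ∈ Set.Icc 0 s, x + τ • u ∈ D := fun τ hτ =>
    hf.line_mem hx hxu ⟨hτ.1, hτ.2.trans hs.2⟩
  have hτr : ∀ τ ∈ Set.Icc 0 s, 0 < 1 - τ * r := by
    intro τ hτ
    nlinarith [hτ.1, hτ.2, hs.2]
  have hb : ∀ τ ∈ Set.Icc 0 s, |third f (x + τ • u) u v v| * (1 - τ * r) ≤
      2 * r * hess f (x + τ • u) v v := by
    intro τ hτ
    have h1 := hf.abs_third_le (hmem τ hτ) u v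
    have h2 := hf.localNorm_line_le hx hxu ⟨hτ.1, hτ.2.trans hs.2⟩
      (by linarith [hτr τ hτ] : τ * localNorm f x u < 1)
    rw [le_div_iff₀ (hτr τ hτ)] at h2
    have h3 := mul_le_mul_of_nonneg_right h1 (hτr τ hτ).le
    have h4 := mul_le_mul_of_nonneg_right h2 (hf.hess_nonneg (hmem τ hτ) v)
    nlinarith
  have hlin : ∀ τ : ℝ, HasDerivAt (fun τ : ℝ => 1 - τ * r) (-r) τ := fun τ => by
    simpa using ((hasDerivAt_id τ).mul_const r).const_sub 1
  constructor
  · have := le_of_hasDerivAt_nonneg hs.1 (φ := fun τ => hess f (x + τ • u) v v / (1 - τ * r) ^ 2)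
      (fun τ hτ => (hf.hasDerivAt_hess (hmem τ hτ) v v).div ((hlin τ).pow 2)
        (pow_pos (hτr τ hτ) 2).ne')
      (fun τ hτ => by
        refine div_nonneg ?_ (by positivity)
        have h1 := hτr τ hτ
        have h2 := neg_abs_le (third f (x + τ • u) u v v)
        have h3 := hb τ hτ
        have h4 : 0 ≤ third f (x + τ • u) u v v * (1 - τ * r) + 2 * r * hess f (x + τ • u) v v := by
          nlinarith
        have := mul_nonneg h4 h1.le
        simp only [Pi.pow_apply]
        norm_num
        nlinarith)
    simp only [zero_smul, add_zero, zero_mul, sub_zero, one_pow, div_one] at this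
    rw [le_div_iff₀ (pow_pos (hτr s (Set.right_mem_Icc.2 hs.1)) 2)] at this
    linarith
  · have := le_of_hasDerivAt_nonneg hs.1
      (φ := fun τ => -(hess f (x + τ • u) v v * (1 - τ * r) ^ 2))
      (fun τ hτ => ((hf.hasDerivAt_hess (hmem τ hτ) v v).mul ((hlin τ).pow 2)).neg)
      (fun τ hτ => by
        have h1 := hτr τ hτ
        have h2 := le_abs_self (third f (x + τ • u) u v v)
        have h3 := hb τ hτ
        have h4 : 0 ≤ -(third f (x + τ • u) u v v * (1 - τ * r)) +
            2 * r * hess f (x + τ • u) v v := by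
          nlinarith
        have := mul_nonneg h4 h1.le
        simp only [Pi.pow_apply]
        norm_num
        nlinarith)
    simp only [zero_smul, add_zero, zero_mul, sub_zero, one_pow, mul_one] at this
    linarith

theorem localNorm_le_div (hf : IsNondegenerate D f) {x y : E n} (hx : x ∈ D) (hy : y ∈ D)
    (hr : localNorm f x (y - x) < 1) (v : E n) :
    (1 - localNorm f x (y - x)) * localNorm f x v ≤ localNorm f y v ∧
      (1 - localNorm f x (y - x)) * localNorm f y v ≤ localNorm f x v := by
  have hxu : x + (y - x) ∈ D := by simpa using hy
  have h := hf.hess_line_bounds hx hxu (Set.right_mem_Icc.2 zero_le_one) hr v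
  simp only [one_mul, one_smul, add_sub_cancel] at h
  have h0 : 0 ≤ 1 - localNorm f x (y - x) := by linarith
  constructor
  · refine Real.le_sqrt_of_sq_le ?_
    rw [mul_pow, hf.localNorm_sq hx]
    exact h.1
  · refine Real.le_sqrt_of_sq_le ?_
    rw [mul_pow, hf.localNorm_sq hy]
    exact h.2

/-- Integrates `φ'' ≥ r²/(1 + τr)²`. A second integration produces `omega` in `value_lower`. -/
theorem grad_line_lower (hf : IsNondegenerate D f) {x u : E n} (hx : x ∈ D) (hxu : x + u ∈ D)
    {s : ℝ} (hs : s ∈ Set.Icc (0 : ℝ) 1) :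
    localNorm f x u - localNorm f x u / (1 + s * localNorm f x u) ≤
      fderiv ℝ f (x + s • u) u - fderiv ℝ f x u := by
  set r := localNorm f x u with hrdef
  have hr0 : 0 ≤ r := localNorm_nonneg _ _ _
  have hI : ∀ τ ∈ Set.Icc 0 s, τ ∈ Set.Icc (0 : ℝ) 1 := fun τ hτ => ⟨hτ.1, hτ.2.trans hs.2⟩
  have hlin : ∀ τ : ℝ, HasDerivAt (fun τ : ℝ => 1 + τ * r) r τ := fun τ => by
    simpa using ((hasDerivAt_id τ).mul_const r).const_add 1
  have hp : ∀ τ ∈ Set.Icc 0 s, 0 < 1 + τ * r := fun τ hτ => by nlinarith [hτ.1, mul_nonneg hτ.1 hr0]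
  have := le_of_hasDerivAt_nonneg hs.1
    (fun τ hτ => (hf.hasDerivAt_grad (hf.line_mem hx hxu (hI τ hτ)) u).add
      (((hlin τ).inv (hp τ hτ).ne').const_mul r))
    (fun τ hτ => by
      have h1 := hf.le_localNorm_line hx hxu (hI τ hτ)
      have h2 := pow_le_pow_left₀ (div_nonneg hr0 (hp τ hτ).le) h1 2
      rw [hf.localNorm_sq (hf.line_mem hx hxu (hI τ hτ)), div_pow] at h2
      have : r * (-r / (1 + τ * r) ^ 2) = -(r ^ 2 / (1 + τ * r) ^ 2) := by ring
      rw [this]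
      linarith)
  simp only [Pi.add_apply, Pi.inv_apply, zero_smul, add_zero, zero_mul, inv_one, mul_one] at this
  rw [div_eq_mul_inv]
  linarith

theorem grad_line_upper (hf : IsNondegenerate D f) {x u : E n} (hx : x ∈ D) (hxu : x + u ∈ D)
    {s : ℝ} (hs : s ∈ Set.Icc (0 : ℝ) 1) (hr : s * localNorm f x u < 1) :
    fderiv ℝ f (x + s • u) u - fderiv ℝ f x u ≤
      localNorm f x u / (1 - s * localNorm f x u) - localNorm f x u := by
  set r := localNorm f x u with hrdef
  have hr0 : 0 ≤ r := localNorm_nonneg _ _ _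
  have hI : ∀ τ ∈ Set.Icc 0 s, τ ∈ Set.Icc (0 : ℝ) 1 := fun τ hτ => ⟨hτ.1, hτ.2.trans hs.2⟩
  have hlin : ∀ τ : ℝ, HasDerivAt (fun τ : ℝ => 1 - τ * r) (-r) τ := fun τ => by
    simpa using ((hasDerivAt_id τ).mul_const r).const_sub 1
  have hp : ∀ τ ∈ Set.Icc 0 s, 0 < 1 - τ * r := fun τ hτ => by
    nlinarith [mul_le_mul_of_nonneg_right hτ.2 hr0]
  have := le_of_hasDerivAt_nonneg hs.1
    (fun τ hτ => (((hlin τ).inv (hp τ hτ).ne').const_mul r).sub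
      (hf.hasDerivAt_grad (hf.line_mem hx hxu (hI τ hτ)) u))
    (fun τ hτ => by
      have h1 := hf.localNorm_line_le hx hxu (hI τ hτ) (by linarith [hp τ hτ])
      have h2 := pow_le_pow_left₀ (localNorm_nonneg _ _ _) h1 2
      rw [hf.localNorm_sq (hf.line_mem hx hxu (hI τ hτ)), div_pow] at h2
      have : r * (- -r / (1 - τ * r) ^ 2) = (r ^ 2 / (1 - τ * r) ^ 2) := by ring
      rw [this]
      linarith)
  simp only [Pi.sub_apply, Pi.inv_apply, zero_smul, add_zero, zero_mul, sub_zero, inv_one,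
    mul_one] at this
  rw [div_eq_mul_inv]
  linarith

theorem grad_sub_lower (hf : IsNondegenerate D f) {x y : E n} (hx : x ∈ D) (hy : y ∈ D) :
    localNorm f x (y - x) ^ 2 / (1 + localNorm f x (y - x)) ≤
      fderiv ℝ f y (y - x) - fderiv ℝ f x (y - x) := by
  have hxu : x + (y - x) ∈ D := by simpa using hy
  have h := hf.grad_line_lower hx hxu (Set.right_mem_Icc.2 zero_le_one)
  simp only [one_mul, one_smul, add_sub_cancel] at h
  have hr0 := localNorm_nonneg f x (y - x)
  convert h using 1
  field_simp
  ring

theorem value_lower (hf : IsNondegenerate D f) {x y : E n} (hx : x ∈ D) (hy : y ∈ D) :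
    f x + fderiv ℝ f x (y - x) + omega (localNorm f x (y - x)) ≤ f y := by
  have hxu : x + (y - x) ∈ D := by simpa using hy
  set u := y - x with hu
  set r := localNorm f x u with hrdef
  have hr0 : 0 ≤ r := localNorm_nonneg _ _ _
  have hlin : ∀ τ : ℝ, HasDerivAt (fun τ : ℝ => 1 + τ * r) r τ := fun τ => by
    simpa using ((hasDerivAt_id τ).mul_const r).const_add 1
  have hp : ∀ τ ∈ Set.Icc (0 : ℝ) 1, 0 < 1 + τ * r := fun τ hτ => by
    nlinarith [hτ.1, mul_nonneg hτ.1 hr0]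
  have := le_of_hasDerivAt_nonneg zero_le_one
    (fun τ hτ => ((hf.hasDerivAt_apply (hf.line_mem hx hxu hτ)).sub
      ((hasDerivAt_id τ).mul_const (fderiv ℝ f x u + r))).add ((hlin τ).log (hp τ hτ).ne'))
    (fun τ hτ => by
      have := hf.grad_line_lower hx hxu hτ
      rw [one_mul]
      linarith)
  simp only [Pi.add_apply, Pi.sub_apply, id, zero_smul, add_zero, zero_mul, one_mul, one_smul,
    Real.log_one, sub_zero] at this
  have e : x + u = y := by simp [hu]
  rw [e] at this
  rw [omega]
  linarith

theorem value_upper (hf : IsNondegenerate D f) {x u : E n} (hx : x ∈ D) (hxu : x + u ∈ D)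
    (hr : localNorm f x u < 1) :
    f (x + u) ≤ f x + fderiv ℝ f x u - localNorm f x u - Real.log (1 - localNorm f x u) := by
  set r := localNorm f x u with hrdef
  have hr0 : 0 ≤ r := localNorm_nonneg _ _ _
  have hlin : ∀ τ : ℝ, HasDerivAt (fun τ : ℝ => 1 - τ * r) (-r) τ := fun τ => by
    simpa using ((hasDerivAt_id τ).mul_const r).const_sub 1
  have hp : ∀ τ ∈ Set.Icc (0 : ℝ) 1, 0 < 1 - τ * r := fun τ hτ => by
    nlinarith [mul_le_mul_of_nonneg_right hτ.2 hr0]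
  have := le_of_hasDerivAt_nonneg zero_le_one
    (fun τ hτ => (((hasDerivAt_id τ).mul_const (fderiv ℝ f x u - r)).sub
      ((hlin τ).log (hp τ hτ).ne')).sub (hf.hasDerivAt_apply (hf.line_mem hx hxu hτ)))
    (fun τ hτ => by
      have := hf.grad_line_upper hx hxu hτ (by linarith [hp τ hτ])
      rw [one_mul, neg_div]
      linarith)
  simp only [Pi.sub_apply, id, zero_smul, add_zero, zero_mul, one_mul, one_smul,
    Real.log_one, sub_zero] at this
  linarith

/-- The Hessian bounds control the diagonal of `∇²f(x + τu) - ∇²f(x)` by `1/(1 - τr)² - 1` times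
`∇²f(x)`. Polarization extends this to the pair `(u, v)`, and integrating over `τ` gives `r²/(1 -
r)`. -/
theorem grad_remainder_le (hf : IsNondegenerate D f) {x u : E n} (hx : x ∈ D) (hxu : x + u ∈ D)
    (hr : localNorm f x u < 1) (v : E n) :
    fderiv ℝ f (x + u) v - fderiv ℝ f x v - hess f x u v ≤
      localNorm f x u ^ 2 / (1 - localNorm f x u) * localNorm f x v := by
  set r := localNorm f x u with hrdef
  have hr0 : 0 ≤ r := localNorm_nonneg _ _ _
  have hlin : ∀ τ : ℝ, HasDerivAt (fun τ : ℝ => 1 - τ * r) (-r) τ := fun τ => by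
    simpa using ((hasDerivAt_id τ).mul_const r).const_sub 1
  have hp : ∀ τ ∈ Set.Icc (0 : ℝ) 1, 0 < 1 - τ * r := fun τ hτ => by
    nlinarith [mul_le_mul_of_nonneg_right hτ.2 hr0]
  have := le_of_hasDerivAt_nonneg zero_le_one
    (fun τ hτ => ((((hlin τ).inv (hp τ hτ).ne').sub ((hasDerivAt_id τ).mul_const r)).mul_const
      (localNorm f x v)).sub ((hf.hasDerivAt_grad (hf.line_mem hx hxu hτ) v).sub
        ((hasDerivAt_id τ).mul_const (hess f x u v))))
    (fun τ hτ => by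
      have hD := hf.line_mem hx hxu hτ
      have hpos := hp τ hτ
      have hb := fun w => hf.hess_line_bounds hx hxu hτ hr w
      have hC := abs_bilin_le_of_abs_diag_le
        (B := fderiv ℝ (fderiv ℝ f) (x + τ • u) - fderiv ℝ (fderiv ℝ f) x)
        (H := fderiv ℝ (fderiv ℝ f) x) (c := 1 / (1 - τ * r) ^ 2 - 1)
        (fun a b => by
          have h1 := hf.hess_symm hD a b
          have h2 := hf.hess_symm hx a b
          simp only [hess] at h1 h2
          simp only [sub_apply, h1, h2])
        (hf.pos x hx) (hf.hess_symm hx)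
        (fun w => by
          obtain ⟨h1, h2⟩ := hb w
          have hn := hf.hess_nonneg hx w
          change |hess f (x + τ • u) w w - hess f x w w| ≤ (1 / (1 - τ * r) ^ 2 - 1) * hess f x w w
          have hq : 0 < (1 - τ * r) ^ 2 := pow_pos hpos 2
          have h3 : hess f (x + τ • u) w w ≤ 1 / (1 - τ * r) ^ 2 * hess f x w w := by
            rw [one_div, inv_mul_eq_div, le_div_iff₀ hq]
            linarith
          -- From `q + 1/q ≥ 2`: the lower deviation of the Hessian is no larger than the upper one.
          have h4 : 2 - (1 - τ * r) ^ 2 ≤ 1 / (1 - τ * r) ^ 2 := by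
            rw [le_div_iff₀ hq]
            nlinarith [sq_nonneg ((1 - τ * r) ^ 2 - 1)]
          have h5 := mul_le_mul_of_nonneg_right h4 hn
          rw [abs_le]
          constructor <;> linarith) u v
      have h6 := (abs_le.1 hC).2
      change hess f (x + τ • u) u v - hess f x u v ≤
        (1 / (1 - τ * r) ^ 2 - 1) * (r * localNorm f x v) at h6
      have e : (- -r / (1 - τ * r) ^ 2 - 1 * r) * localNorm f x v =
        (1 / (1 - τ * r) ^ 2 - 1) * (r * localNorm f x v) := by ring
      rw [e, one_mul]
      linarith)
  simp only [Pi.sub_apply, Pi.inv_apply, id, zero_smul, add_zero, zero_mul, one_mul, one_smul,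
    sub_zero, inv_one] at this
  have h1 : (1 - r) ≠ 0 := by linarith
  have e : r ^ 2 / (1 - r) = (1 - r)⁻¹ - r - 1 := by
    field_simp
    ring
  rw [e]
  linarith

end IsNondegenerate

end ProxPath

namespace ProxPath

variable {n : ℕ} {Ω D : Set (E n)} {f : E n → ℝ} {ν : ℝ}

/-! ### Barrier inequalities -/

namespace IsBarrier

theorem nondegenerate (hf : IsBarrier Ω D f ν)
    (hpos : ∀ x ∈ D, ∀ u : E n, u ≠ 0 → 0 < hess f x u u) : IsNondegenerate D f :=
  { hf.selfConcordant with pos := hpos }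

/-- Use the barrier inequality at the multiple of `u` that maximizes its left side. -/
theorem grad_sq_le (hf : IsBarrier Ω D f ν)
    (hpos : ∀ x ∈ D, ∀ u : E n, u ≠ 0 → 0 < hess f x u u) {x : E n} (hx : x ∈ D) (u : E n) :
    fderiv ℝ f x u ^ 2 ≤ ν * hess f x u u := by
  by_cases hu : u = 0
  · simp [hu, hess]
  have hp := hpos x hx u hu
  have h := hf.bound x hx ((fderiv ℝ f x u / hess f x u u) • u)
  rw [hess_smul_smul, map_smul, smul_eq_mul] at h
  have e : 2 * (fderiv ℝ f x u / hess f x u u * fderiv ℝ f x u) -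
      (fderiv ℝ f x u / hess f x u u) ^ 2 * hess f x u u = fderiv ℝ f x u ^ 2 / hess f x u u := by
    field_simp
    ring
  rw [e, div_le_iff₀ hp] at h
  exact h

theorem abs_grad_le (hf : IsBarrier Ω D f ν)
    (hpos : ∀ x ∈ D, ∀ u : E n, u ≠ 0 → 0 < hess f x u u) (hν : 0 < ν) {x : E n} (hx : x ∈ D)
    (u : E n) : |fderiv ℝ f x u| ≤ √ν * localNorm f x u := by
  refine abs_le_of_sq_le_sq ?_ (mul_nonneg (Real.sqrt_nonneg _) (localNorm_nonneg _ _ _))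
  rw [mul_pow, Real.sq_sqrt hν.le, (hf.nondegenerate hpos).localNorm_sq hx]
  exact hf.grad_sq_le hpos hx u

/-- With `φ'` the slope along the segment, `-1/φ'` grows at rate at least `1/ν`. A start with `φ'(0)
> ν` would force `1/φ'(1) < 0`. -/
theorem grad_sub_le (hf : IsBarrier Ω D f ν)
    (hpos : ∀ x ∈ D, ∀ u : E n, u ≠ 0 → 0 < hess f x u u) (hν : 0 < ν) {x y : E n} (hx : x ∈ D)
    (hy : y ∈ D) : fderiv ℝ f x (y - x) ≤ ν := by
  have hnd := hf.nondegenerate hpos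
  have hxu : x + (y - x) ∈ D := by simpa using hy
  set u := y - x with hu
  by_contra! hlt
  have hp0 : 0 < fderiv ℝ f x u := hν.trans hlt
  have hmono : ∀ s ∈ Set.Icc (0 : ℝ) 1, fderiv ℝ f x u ≤ fderiv ℝ f (x + s • u) u := by
    intro s hs
    have hI : ∀ τ ∈ Set.Icc 0 s, τ ∈ Set.Icc (0 : ℝ) 1 := fun τ hτ => ⟨hτ.1, hτ.2.trans hs.2⟩
    have := le_of_hasDerivAt_nonneg hs.1
      (fun τ hτ => hnd.hasDerivAt_grad (hnd.line_mem hx hxu (hI τ hτ)) u)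
      (fun τ hτ => hnd.hess_nonneg (hnd.line_mem hx hxu (hI τ hτ)) u)
    simpa using this
  have := le_of_hasDerivAt_nonneg zero_le_one
    (fun τ hτ => ((hnd.hasDerivAt_grad (hnd.line_mem hx hxu hτ) u).inv
      (hp0.trans_le (hmono τ hτ)).ne').add ((hasDerivAt_id τ).mul_const ν⁻¹) |>.neg)
    (fun τ hτ => by
      have h1 := hf.grad_sq_le hpos (hnd.line_mem hx hxu hτ) u
      have h2 := hp0.trans_le (hmono τ hτ)
      rw [neg_add, neg_div, neg_neg, one_mul]
      have : ν⁻¹ ≤ hess f (x + τ • u) u u / fderiv ℝ f (x + τ • u) u ^ 2 := by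
        rw [le_div_iff₀ (pow_pos h2 2), inv_mul_le_iff₀ hν]
        exact h1
      linarith)
  simp only [Pi.neg_apply, Pi.add_apply, Pi.inv_apply, id, zero_smul, add_zero, zero_mul, one_mul,
    one_smul] at this
  have h3 : (fderiv ℝ f x u)⁻¹ < ν⁻¹ := inv_strictAnti₀ hν hlt
  have h4 : 0 < (fderiv ℝ f (x + u) u)⁻¹ := by
    have := hmono 1 (Set.right_mem_Icc.2 zero_le_one)
    rw [one_smul] at this
    exact inv_pos.2 (hp0.trans_le this)
  linarith

/-- On the whole space, `grad_sub_le` at distant points kills the gradient and hence the Hessian. -/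
theorem ne_univ (hf : IsBarrier Ω D f ν)
    (hpos : ∀ x ∈ D, ∀ u : E n, u ≠ 0 → 0 < hess f x u u) (hν : 0 < ν) (hn : 0 < n) :
    D ≠ Set.univ := by
  intro hD
  have hnd := hf.nondegenerate hpos
  have hmem : ∀ x, x ∈ D := fun x => hD ▸ Set.mem_univ x
  have hgrad : ∀ x u, fderiv ℝ f x u = 0 := by
    have hle : ∀ x u, fderiv ℝ f x u ≤ 0 := by
      intro x u
      by_contra! h
      have := hf.grad_sub_le hpos hν (hmem x) (hmem (x + (2 * ν / fderiv ℝ f x u) • u))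
      rw [add_sub_cancel_left, map_smul, smul_eq_mul, div_mul_cancel₀ _ h.ne'] at this
      linarith
    intro x u
    have h := hle x (-u)
    rw [map_neg] at h
    linarith [hle x u]
  obtain ⟨u, hu⟩ : ∃ u : E n, u ≠ 0 := by
    have : Nonempty (Fin n) := ⟨⟨0, hn⟩⟩
    exact exists_ne 0
  have h0 := hnd.hasDerivAt_grad (x := 0) (u := u) (s := 0) (hmem _) u
  simp only [hgrad] at h0
  have := h0.unique (hasDerivAt_const 0 0)
  have h1 := hpos (0 + (0 : ℝ) • u) (hmem _) u hu
  linarith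

/-- A self-concordant barrier with nondegenerate Hessian on a nontrivial space has parameter at
least one. -/
theorem one_le (hf : IsBarrier Ω D f ν)
    (hpos : ∀ x ∈ D, ∀ u : E n, u ≠ 0 → 0 < hess f x u u) (hν : 0 < ν) (hn : 0 < n) :
    1 ≤ ν := by
  by_contra! hν1
  have hnd := hf.nondegenerate hpos
  obtain ⟨x, hx⟩ := hnd.nonempty
  obtain ⟨y, hy⟩ : (frontier D).Nonempty := by
    rw [Set.nonempty_iff_ne_empty]
    intro h
    rcases isClopen_iff.1 (isClopen_iff_frontier_eq_empty.2 h) with h | h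
    · rw [h] at hx; exact hx
    · exact hf.ne_univ hpos hν hn h
  have hyD : y ∉ D := fun h => by
    have : y ∈ D ∩ frontier D := ⟨h, hy⟩
    rwa [hnd.isOpen.inter_frontier_eq] at this
  set u := y - x with hu
  have hu0 : u ≠ 0 := fun h => hyD (by rwa [sub_eq_zero.1 h])
  have hmem : ∀ s : ℝ, 0 ≤ s → s < 1 → x + s • u ∈ D := by
    intro s h0 h1
    have := hnd.convexOn.1.combo_interior_closure_mem_interior (x := x) (y := y)
      (by rwa [hnd.isOpen.interior_eq]) (frontier_subset_closure hy) (a := 1 - s) (b := s)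
      (by linarith) h0 (by ring)
    rw [hnd.isOpen.interior_eq] at this
    convert this using 1
    rw [hu, smul_sub, sub_smul, one_smul]
    abel
  have htend : Filter.Tendsto (fun s : ℝ => f (x + s • u)) (𝓝[<] 1) Filter.atTop := by
    refine (hnd.closed y hy).comp (tendsto_nhdsWithin_iff.2 ⟨?_, ?_⟩)
    · have := (hasDerivAt_line x u 1).continuousAt.tendsto
      simp only [one_smul] at this
      rw [show x + u = y by simp [hu]] at this
      exact this.mono_left nhdsWithin_le_nhds
    · have : Set.Ioo (0 : ℝ) 1 ∈ 𝓝[<] (1 : ℝ) := Ioo_mem_nhdsLT zero_lt_one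
      filter_upwards [this] with s hs using hmem s hs.1.le hs.2
  have hbig : ∀ M s₀ : ℝ, s₀ < 1 → ∃ s, s₀ < s ∧ s < 1 ∧ M < f (x + s • u) := by
    intro M s₀ hs₀
    obtain ⟨s, h1, h2⟩ := ((htend.eventually_gt_atTop M).and (Ioo_mem_nhdsLT hs₀)).exists
    exact ⟨s, h2.1, h2.2, h1⟩
  obtain ⟨s₀, h00, h01, hg0⟩ : ∃ s₀ : ℝ, 0 ≤ s₀ ∧ s₀ < 1 ∧ 0 < fderiv ℝ f (x + s₀ • u) u := by
    by_contra! h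
    obtain ⟨s, h1, h2, h3⟩ := hbig (f x) 0 zero_lt_one
    have := le_of_hasDerivAt_nonneg h1.le
      (fun τ hτ => (hnd.hasDerivAt_apply (hmem τ hτ.1 (hτ.2.trans_lt h2))).neg)
      (fun τ hτ => neg_nonneg.2 (h τ hτ.1 (hτ.2.trans_lt h2)))
    simp only [Pi.neg_apply, zero_smul, add_zero] at this
    linarith
  -- If `ν < 1`, then `φ'²/φ''` has derivative at least `c φ'` wherever `φ' > 0`. So `φ'²/φ'' - c φ`
  -- increases, although `φ'²/φ'' ≤ ν` while `φ` blows up at the boundary point.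
  set c := 2 * (1 - √ν) with hc
  have hsν : √ν < 1 := by rw [Real.sqrt_lt' one_pos]; simpa using hν1
  have hcpos : 0 < c := by rw [hc]; linarith
  obtain ⟨s, h1, h2, h3⟩ := hbig (f (x + s₀ • u) + ν / c) s₀ h01
  have hm : ∀ τ ∈ Set.Icc s₀ s, x + τ • u ∈ D := fun τ hτ =>
    hmem τ (h00.trans hτ.1) (hτ.2.trans_lt h2)
  have hgpos : ∀ τ ∈ Set.Icc s₀ s, 0 < fderiv ℝ f (x + τ • u) u := by
    intro τ hτ
    refine hg0.trans_le ?_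
    exact le_of_hasDerivAt_nonneg (φ := fun τ => fderiv ℝ f (x + τ • u) u) hτ.1
      (fun σ hσ => hnd.hasDerivAt_grad (hm σ ⟨hσ.1, hσ.2.trans hτ.2⟩) u)
      (fun σ hσ => hnd.hess_nonneg (hm σ ⟨hσ.1, hσ.2.trans hτ.2⟩) u)
  have := le_of_hasDerivAt_nonneg h1.le
    (fun τ hτ => (((hnd.hasDerivAt_grad (hm τ hτ) u).pow 2).div (hnd.hasDerivAt_hess (hm τ hτ) u u)
      (hpos _ (hm τ hτ) u hu0).ne').sub ((hnd.hasDerivAt_apply (hm τ hτ)).const_mul c))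
    (fun τ hτ => by
      have hD := hm τ hτ
      have hG := hgpos τ hτ
      have hP := hnd.localNorm_pos hD hu0
      have hL : fderiv ℝ f (x + τ • u) u ≤ √ν * localNorm f (x + τ • u) u :=
        (abs_le.1 (hf.abs_grad_le hpos hν hD u)).2
      have hT := (abs_le.1 (hnd.abs_third_diag_le hD u)).2
      rw [← hnd.localNorm_sq hD u]
      simp only [Pi.pow_apply]
      generalize localNorm f (x + τ • u) u = p at *
      generalize fderiv ℝ f (x + τ • u) u = G at *
      generalize third f (x + τ • u) u u u = T at *
      rw [sub_nonneg, le_div_iff₀ (by positivity), hc]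
      norm_num
      have k1 : G ^ 2 * T ≤ G ^ 2 * (2 * p ^ 3) := mul_le_mul_of_nonneg_left hT (sq_nonneg _)
      have k2 : G * (2 * G * p ^ 3) ≤ (√ν * p) * (2 * G * p ^ 3) :=
        mul_le_mul_of_nonneg_right hL (by positivity)
      nlinarith)
  simp only [Pi.sub_apply, Pi.pow_apply, Pi.div_apply] at this
  have hlo : 0 ≤ fderiv ℝ f (x + s₀ • u) u ^ 2 / hess f (x + s₀ • u) u u :=
    div_nonneg (sq_nonneg _) (hnd.hess_nonneg (hmem _ h00 h01) u)
  have hhi : fderiv ℝ f (x + s • u) u ^ 2 / hess f (x + s • u) u u ≤ ν := by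
    have hD := hm s (Set.right_mem_Icc.2 h1.le)
    rw [div_le_iff₀ (hpos _ hD u hu0)]
    exact hf.grad_sq_le hpos hD u
  have h4 : ν / c * c = ν := div_mul_cancel₀ _ hcpos.ne'
  nlinarith

end IsBarrier

end ProxPath

namespace ProxPath

variable {n : ℕ} {Ω D : Set (E n)} {f : E n → ℝ} {g : E n → EReal} {ν : ℝ}

/-! ### Convexity of the objective and optimality conditions -/

namespace IsProperLscConvex

theorem segment_le (hg : IsProperLscConvex g) {x y : E n} (hx : g x ≠ ⊤) (hy : g y ≠ ⊤) {a : ℝ}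
    (ha : a ∈ Set.Icc (0 : ℝ) 1) :
    g (x + a • (y - x)) ≠ ⊤ ∧
      (g (x + a • (y - x))).toReal ≤ (g x).toReal + a * ((g y).toReal - (g x).toReal) := by
  have hxm : (x, (g x).toReal) ∈ {p : E n × ℝ | g p.1 ≤ (p.2 : EReal)} :=
    (EReal.coe_toReal hx (hg.ne_bot x)).ge
  have hym : (y, (g y).toReal) ∈ {p : E n × ℝ | g p.1 ≤ (p.2 : EReal)} :=
    (EReal.coe_toReal hy (hg.ne_bot y)).ge
  have h := hg.convex_epigraph.add_smul_sub_mem hxm hym ha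
  have h' : g (x + a • (y - x)) ≤
      (((g x).toReal + a * ((g y).toReal - (g x).toReal) : ℝ) : EReal) := h
  have hne : g (x + a • (y - x)) ≠ ⊤ := ne_top_of_le_ne_top (EReal.coe_ne_top _) h'
  refine ⟨hne, ?_⟩
  rwa [← EReal.coe_toReal hne (hg.ne_bot _), EReal.coe_le_coe_iff] at h'

theorem segment_mem_domF (hg : IsProperLscConvex g) (hD : Convex ℝ D) {x y : E n}
    (hx : x ∈ domF D g) (hy : y ∈ domF D g) {a : ℝ} (ha : a ∈ Set.Icc (0 : ℝ) 1) :
    x + a • (y - x) ∈ domF D g :=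
  ⟨hD.add_smul_sub_mem hx.1 hy.1 ha, (hg.segment_le hx.2 hy.2 ha).1⟩

end IsProperLscConvex

theorem deriv_nonneg_of_right_min {φ : ℝ → ℝ} {φ' : ℝ} (h : HasDerivAt φ φ' 0)
    (hmin : ∀ a, 0 < a → a < 1 → φ 0 ≤ φ a) : 0 ≤ φ' := by
  have h1 : Filter.Tendsto (slope φ 0) (𝓝[>] 0) (𝓝 φ') :=
    (hasDerivAt_iff_tendsto_slope.1 h).mono_left
      (nhdsWithin_mono _ (fun a (ha : 0 < a) => ne_of_gt ha))
  refine ge_of_tendsto h1 ?_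
  filter_upwards [Ioo_mem_nhdsGT (zero_lt_one' ℝ)] with a ha
  rw [slope_def_field]
  exact div_nonneg (sub_nonneg.2 (hmin a ha.1 ha.2)) (by linarith [ha.1])

/-- The condition `-t ∇f(b) ∈ ∂g(b)`, read off the right derivative of `F` with `g` replaced by its
chord. Only the open segment has to lie in `D`, so `z` may be a boundary point. -/
theorem IsCentralPoint.variational (hnd : IsNondegenerate D f) (hg : IsProperLscConvex g) {t : ℝ}
    (ht : 0 < t) {b : E n} (hb : IsCentralPoint D f g t b) {z : E n} (hz : g z ≠ ⊤)
    (hseg : ∀ a : ℝ, 0 < a → a < 1 → b + a • (z - b) ∈ D) :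
    (g b).toReal - (g z).toReal ≤ t * fderiv ℝ f b (z - b) := by
  have hb0 : b + (0 : ℝ) • (z - b) ∈ D := by simpa using hb.1.1
  have h := deriv_nonneg_of_right_min ((hnd.hasDerivAt_apply hb0).add
    ((hasDerivAt_id 0).mul_const (t⁻¹ * ((g z).toReal - (g b).toReal)))) (fun a h0 h1 => by
      obtain ⟨k1, k2⟩ := hg.segment_le hb.1.2 hz ⟨h0.le, h1.le⟩
      have k3 := hb.2 _ ⟨hseg a h0 h1, k1⟩
      have k4 := mul_le_mul_of_nonneg_left k2 (inv_pos.2 ht).le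
      simp only [Pi.add_apply, id, zero_smul, add_zero, zero_mul]
      simp only [F] at k3
      linarith)
  rw [zero_smul, add_zero, one_mul] at h
  have h2 := mul_nonneg ht.le h
  rw [mul_add, mul_inv_cancel_left₀ ht.ne'] at h2
  linarith

theorem IsCentralPoint.variational_of_mem (hnd : IsNondegenerate D f) (hg : IsProperLscConvex g)
    {t : ℝ} (ht : 0 < t) {b : E n} (hb : IsCentralPoint D f g t b) {z : E n}
    (hz : z ∈ domF D g) : (g b).toReal - (g z).toReal ≤ t * fderiv ℝ f b (z - b) :=
  hb.variational hnd hg ht hz.2 fun _ h0 h1 =>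
    hnd.convexOn.1.add_smul_sub_mem hb.1.1 hz.1 ⟨h0.le, h1.le⟩

/-- Along the central path the objective exceeds its constrained minimum by at most `ν t`. -/
theorem IsBarrier.central_gap_le (hf : IsBarrier Ω D f ν)
    (hpos : ∀ x ∈ D, ∀ u : E n, u ≠ 0 → 0 < hess f x u u) (hν : 0 < ν)
    (hg : IsProperLscConvex g) {t : ℝ} (ht : 0 < t) {b : E n} (hb : IsCentralPoint D f g t b)
    {z : E n} (hzΩ : z ∈ Ω) (hz : g z ≠ ⊤) : (g b).toReal - (g z).toReal ≤ ν * t := by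
  have hnd := hf.nondegenerate hpos
  have hseg : ∀ a : ℝ, 0 < a → a < 1 → b + a • (z - b) ∈ D := by
    intro a h0 h1
    have := hnd.convexOn.1.combo_interior_closure_mem_interior (x := b) (y := z)
      (by rw [hnd.isOpen.interior_eq]; exact hb.1.1) (by rwa [hf.closure_eq]) (a := 1 - a) (b := a)
      (by linarith) h0.le (by ring)
    rw [hnd.isOpen.interior_eq] at this
    convert this using 1
    rw [smul_sub, sub_smul, one_smul]
    abel
  have h := hb.variational hnd hg ht hz hseg
  suffices fderiv ℝ f b (z - b) ≤ ν by nlinarith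
  by_contra! hlt
  set p := fderiv ℝ f b (z - b) with hp
  have hp0 : 0 < p := hν.trans hlt
  have ha1 : ν / p < 1 := (div_lt_one hp0).2 hlt
  have ha0 : 0 < ν / p := div_pos hν hp0
  -- `z` may lie outside `D`; stopping short of it, at a fraction strictly between `ν/p` and 1,
  -- already pairs to more than `ν`.
  have h1 := hf.grad_sub_le hpos hν hb.1.1
    (hseg ((ν / p + 1) / 2) (by linarith) (by linarith))
  rw [add_sub_cancel_left, map_smul, smul_eq_mul, ← hp] at h1
  have : ν / p * p = ν := div_mul_cancel₀ _ hp0.ne'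
  nlinarith

/-! ### Phase I -/

theorem damped_step_decrease (hnd : IsNondegenerate D f) (hg : IsProperLscConvex g) {t : ℝ}
    (ht : 0 < t) {κ δ : ℝ} (hκ0 : 0 < κ) (hκ1 : κ < 1) {y s : E n} (hy : y ∈ domF D g)
    (hδ0 : 0 ≤ δ) (hδ : δ ≤ κ * localNorm f y (s - y)) (hs : IsDeltaSolution D f g t y δ s) :
    y + ((1 - κ) / (1 + (1 - κ) * localNorm f y (s - y))) • (s - y) ∈ domF D g ∧
    F f g t (y + ((1 - κ) / (1 + (1 - κ) * localNorm f y (s - y))) • (s - y)) ≤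
      F f g t y - omega ((1 - κ) * localNorm f y (s - y)) := by
  set d := s - y with hd
  set ζ := localNorm f y d with hζ
  have hζ0 : 0 ≤ ζ := localNorm_nonneg _ _ _
  set e := (1 - κ) * ζ with he
  have he0 : 0 ≤ e := mul_nonneg (by linarith) hζ0
  set α := (1 - κ) / (1 + e) with hα
  have hα0 : 0 ≤ α := div_nonneg (by linarith) (by linarith)
  have hα1 : α ≤ 1 := by rw [hα, div_le_one (by linarith)]; linarith
  have hmem := hg.segment_mem_domF hnd.convexOn.1 hy hs.1 ⟨hα0, hα1⟩
  refine ⟨hmem, ?_⟩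
  -- Test the near-optimality of `s` at the point a fraction `κ` back towards `y`. The error `δ² ≤
  -- (κζ)²` then leaves exactly `-κ(1 - κ)ζ²`.
  have hA : fderiv ℝ f y d + t⁻¹ * ((g s).toReal - (g y).toReal) ≤ -((1 - κ) * ζ ^ 2) := by
    have hκI : κ ∈ Set.Icc (0 : ℝ) 1 := ⟨hκ0.le, hκ1.le⟩
    have h1 := hs.2 _ (hg.segment_mem_domF hnd.convexOn.1 hs.1 hy hκI)
    have h2 := mul_le_mul_of_nonneg_left (hg.segment_le hs.1.2 hy.2 hκI).2 (inv_pos.2 ht).le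
    have e1 : s + κ • (y - s) - y = (1 - κ) • d := by
      rw [hd]; module
    simp only [model] at h1
    rw [e1, ← hd, hess_smul_smul, map_smul, smul_eq_mul, ← hnd.localNorm_sq hy.1, ← hζ] at h1
    have h3 : δ ^ 2 ≤ (κ * ζ) ^ 2 := pow_le_pow_left₀ hδ0 hδ 2
    have h4 : κ * (fderiv ℝ f y d + t⁻¹ * ((g s).toReal - (g y).toReal)) ≤
        κ * -((1 - κ) * ζ ^ 2) := by nlinarith
    exact le_of_mul_le_mul_left h4 hκ0
  have hαζ : localNorm f y (α • d) = e / (1 + e) := by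
    rw [localNorm_smul _ _ _ hα0, ← hζ, hα, he]
    ring
  -- The damping gives the step local norm `e/(1 + e)`, so the logarithmic term becomes `log (1 +
  -- e)` and the decrease is exactly `omega e`.
  have h1 := hnd.value_upper hy.1 hmem.1 (by
    rw [hαζ, div_lt_one (by linarith)]; linarith)
  have h2 := mul_le_mul_of_nonneg_left (hg.segment_le hy.2 hs.1.2 ⟨hα0, hα1⟩).2
    (inv_pos.2 ht).le
  rw [hαζ, map_smul, smul_eq_mul] at h1
  have h3 : 1 - e / (1 + e) = (1 + e)⁻¹ := by
    have : (1 + e) ≠ 0 := by linarith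
    field_simp
    ring
  rw [h3, Real.log_inv] at h1
  have h4 := mul_le_mul_of_nonneg_left hA hα0
  have h5 : α * ((1 - κ) * ζ ^ 2) + e / (1 + e) = e := by
    have : (1 + e) ≠ 0 := by linarith
    rw [hα]
    field_simp
    rw [he]
    ring
  simp only [F, omega]
  linarith

theorem omega_le_omega_iff {a b : ℝ} (ha : 0 ≤ a) (hb : 0 ≤ b) (h : omega a ≤ omega b) :
    a ≤ b := by
  by_contra! hlt
  have h1 : 0 < 1 + b := by linarith
  have h2 := Real.log_lt_sub_one_of_pos (x := (1 + a) / (1 + b)) (by positivity)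
    (by rw [Ne, div_eq_one_iff_eq h1.ne']; linarith)
  rw [Real.log_div (by linarith) h1.ne'] at h2
  have h3 : (1 + a) / (1 + b) - 1 ≤ a - b := by
    rw [div_sub_one h1.ne', div_le_iff₀ h1]
    nlinarith
  simp only [omega] at h
  linarith

theorem omega_le_half_sq {a : ℝ} (ha : 0 ≤ a) : omega a ≤ a ^ 2 / 2 := by
  have := le_of_hasDerivAt_nonneg ha (φ := fun s => s ^ 2 / 2 - (s - Real.log (1 + s)))
    (fun s hs => (((hasDerivAt_id s).pow 2).div_const 2).sub ((hasDerivAt_id s).sub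
      (((hasDerivAt_id s).const_add 1).log (by simp only [id]; linarith [hs.1]))))
    (fun s hs => by
      have h1 : 0 < 1 + s := by linarith [hs.1]
      have : s - (1 - 1 / (1 + s)) = s ^ 2 / (1 + s) := by
        field_simp
        ring
      simp only [id]
      norm_num
      have h2 : 0 ≤ s ^ 2 / (1 + s) := by positivity
      rw [one_div] at this
      linarith)
  simp only [omega]
  norm_num at this
  linarith

theorem IsPhaseIOutput.gap_le (hnd : IsNondegenerate D f) (hg : IsProperLscConvex g)
    {β κ γ₀ t₀ : ℝ} (ht : 0 < t₀) (hκ0 : 0 < κ) (hκ1 : κ < 1) {x₀ out b : E n}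
    (hx₀ : x₀ ∈ domF D g) (hγ : F f g t₀ x₀ - F f g t₀ b ≤ γ₀)
    (h : IsPhaseIOutput D f g β κ γ₀ t₀ x₀ out) :
    out ∈ domF D g ∧ F f g t₀ out - F f g t₀ b ≤ omega β := by
  obtain ⟨J, y, s, hy0, hstep, -, hJ, rfl⟩ := h
  have key : ∀ j ≤ J + 1, y j ∈ domF D g ∧ F f g t₀ (y j) ≤ F f g t₀ x₀ -
      ∑ l ∈ Finset.range j, omega ((1 - κ) * localNorm f (y l) (s l - y l)) := by
    intro j
    induction j with
    | zero => intro _; simp [hy0, hx₀]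
    | succ j ih =>
      intro hj
      obtain ⟨h1, h2⟩ := ih (by omega)
      obtain ⟨⟨δ, hδ0, hδ, hs⟩, hyj⟩ := hstep j (by omega)
      obtain ⟨h3, h4⟩ := damped_step_decrease hnd hg ht hκ0 hκ1 h1 hδ0 hδ hs
      rw [← hyj] at h3 h4
      rw [Finset.sum_range_succ]
      exact ⟨h3, by linarith⟩
  obtain ⟨h1, h2⟩ := key (J + 1) le_rfl
  refine ⟨h1, ?_⟩
  simp only [Gam] at hJ
  linarith

/-- The linear term of `value_lower` is cancelled by optimality of `b`. -/
theorem IsCentralPoint.omega_add_le (hnd : IsNondegenerate D f) (hg : IsProperLscConvex g) {t : ℝ}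
    (ht : 0 < t) {b x : E n} (hb : IsCentralPoint D f g t b) (hx : x ∈ domF D g) :
    omega (localNorm f b (x - b)) ≤ F f g t x - F f g t b := by
  have h1 := hnd.value_lower hb.1.1 hx.1
  have h2 := hb.variational_of_mem hnd hg ht hx
  have h3 := mul_le_mul_of_nonneg_left h2 (inv_pos.2 ht).le
  rw [inv_mul_cancel_left₀ ht.ne'] at h3
  simp only [F]
  linarith

/-! ### Phase II -/

/-- Distance between two points of the central path whose parameters differ by a relative
amount `σ`. -/
theorem central_path_dist (hf : IsBarrier Ω D f ν)
    (hpos : ∀ x ∈ D, ∀ u : E n, u ≠ 0 → 0 < hess f x u u) (hν : 0 < ν)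
    (hg : IsProperLscConvex g) {t t' σ : ℝ} (ht : 0 < t) (ht' : 0 < t')
    (hσ : |t' - t| ≤ σ * t) {a b : E n} (ha : IsCentralPoint D f g t a)
    (hb : IsCentralPoint D f g t' b) {C : ℝ} (hC : 0 ≤ C) (hσC : σ * √ν ≤ C / (1 + C)) :
    localNorm f b (a - b) ≤ C := by
  have hnd := hf.nondegenerate hpos
  have h1 := ha.variational_of_mem hnd hg ht hb.1
  have h2 := hb.variational_of_mem hnd hg ht' ha.1
  have h3 := hnd.grad_sub_lower hb.1.1 ha.1.1
  have h4 := hf.abs_grad_le hpos hν hb.1.1 (a - b)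
  rw [← neg_sub a b, map_neg] at h1
  set Δ := localNorm f b (a - b) with hΔ
  have hΔ0 : 0 ≤ Δ := localNorm_nonneg _ _ _
  set p := fderiv ℝ f a (a - b)
  set q := fderiv ℝ f b (a - b)
  -- Adding the two optimality conditions eliminates `g` and leaves `t p ≤ t' q`.
  have h5 : t * (p - q) ≤ σ * t * (√ν * Δ) := by
    calc t * (p - q) ≤ (t' - t) * q := by linarith
      _ ≤ |t' - t| * |q| := by rw [← abs_mul]; exact le_abs_self _
      _ ≤ σ * t * (√ν * Δ) := mul_le_mul hσ h4 (abs_nonneg _) ((abs_nonneg _).trans hσ)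
  have h6 : p - q ≤ σ * √ν * Δ := by
    refine le_of_mul_le_mul_left ?_ ht
    linarith
  by_contra! hlt
  have hΔp : 0 < Δ := hC.trans_lt hlt
  have h7 : Δ ^ 2 / (1 + Δ) ≤ C / (1 + C) * Δ :=
    h3.trans (h6.trans (mul_le_mul_of_nonneg_right hσC hΔ0))
  rw [div_mul_eq_mul_div, div_le_div_iff₀ (by linarith) (by linarith)] at h7
  have h8 : Δ * (Δ * (1 + C)) ≤ Δ * (C * (1 + Δ)) := by linarith
  have h9 := le_of_mul_le_mul_left h8 hΔp
  linarith

/-- One inexact full proximal-Newton step, measured in the local norms at the base point `x` and at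
the central point `b`. -/
theorem inexact_newton_step (hf : IsBarrier Ω D f ν)
    (hpos : ∀ x ∈ D, ∀ u : E n, u ≠ 0 → 0 < hess f x u u) (hν : 0 < ν)
    (hg : IsProperLscConvex g) {t δ : ℝ} (ht : 0 < t) {b x y : E n}
    (hb : IsCentralPoint D f g t b) (hx : x ∈ domF D g) (hy : IsDeltaSolution D f g t x δ y)
    (hr : localNorm f x (b - x) < 1) :
    localNorm f x (y - b) ^ 2 ≤
        2 * (localNorm f x (b - x) ^ 2 / (1 - localNorm f x (b - x))) * localNorm f x (y - b)
          + δ ^ 2 ∧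
      t⁻¹ * ((g y).toReal - (g b).toReal) ≤
        √ν * localNorm f x (y - b) + localNorm f x (b - x) ^ 2 / 2 + δ ^ 2 / 2 := by
  have hnd := hf.nondegenerate hpos
  have h1 := hy.2 b hb.1
  simp only [model] at h1
  have e1 : y - x = (b - x) + (y - b) := by abel
  -- First bound: optimality of `b` replaces `g` by `∇f(b)`, leaving the gradient remainder at `x`.
  -- Second bound: drop the nonnegative quadratic term at `y` and bound the gradient at `x` by `√ν`.
  constructor
  · have h2 := hb.variational_of_mem hnd hg ht hy.1
    have h3 := mul_le_mul_of_nonneg_left h2 (inv_pos.2 ht).le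
    rw [inv_mul_cancel_left₀ ht.ne'] at h3
    have hxb : x + (b - x) ∈ D := by simpa using hb.1.1
    have h4 := hnd.grad_remainder_le hx.1 hxb hr (y - b)
    rw [add_sub_cancel] at h4
    have e2 : hess f x (y - x) (y - x) = hess f x (b - x) (b - x) + 2 * hess f x (b - x) (y - b) +
        hess f x (y - b) (y - b) := by
      have hsym := hnd.hess_symm hx.1 (y - b) (b - x)
      rw [e1]
      simp only [hess, map_add, add_apply] at hsym ⊢
      linarith
    have e3 : fderiv ℝ f x (y - x) = fderiv ℝ f x (b - x) + fderiv ℝ f x (y - b) := by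
      rw [e1, map_add]
    rw [e2, e3, ← hnd.localNorm_sq hx.1 (y - b)] at h1
    linarith
  · have e3 : fderiv ℝ f x (b - x) - fderiv ℝ f x (y - x) = - fderiv ℝ f x (y - b) := by
      rw [e1, map_add]; ring
    have h2 := (abs_le.1 (hf.abs_grad_le hpos hν hx.1 (y - b))).1
    have h3 := hnd.hess_nonneg hx.1 (y - x)
    rw [← hnd.localNorm_sq hx.1 (b - x)] at h1
    linarith

end ProxPath

namespace ProxPath

variable {n : ℕ} {Ω D : Set (E n)} {f : E n → ℝ} {g : E n → EReal} {ν : ℝ}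

/-! ### Numerical constants -/

theorem sqrt_beta_le {β : ℝ} (hβ' : β ≤ 0.15) : √β ≤ 0.3873 := by
  rw [Real.sqrt_le_left (by norm_num)]
  norm_num at *
  linarith

theorem Cβ_pos {β : ℝ} (hβ : 0 < β) (hβ' : β ≤ 0.15) : 0 < Cβ β := by
  have hs := Real.sqrt_pos.2 hβ
  have hs' := sqrt_beta_le hβ'
  have hsq := Real.sq_sqrt hβ.le
  refine div_pos ?_ (by positivity)
  nlinarith

theorem one_sub_Cβ {β : ℝ} (hβ : 0 < β) : 1 - Cβ β = 2.581 * (1 + β) / (2.581 + √β) := by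
  have hs := Real.sqrt_pos.2 hβ
  rw [Cβ, eq_div_iff (by positivity), sub_mul, div_mul_cancel₀ _ (by positivity)]
  ring

theorem Cβ_lt_one {β : ℝ} (hβ : 0 < β) : Cβ β < 1 := by
  have hs := Real.sqrt_pos.2 hβ
  have h : 0 < 1 - Cβ β := by
    rw [one_sub_Cβ hβ]
    positivity
  linarith

/-- The equation that defines `C(β)`: its left side is the warm-start radius. -/
theorem add_Cβ_div {β : ℝ} (hβ : 0 < β) : (β + Cβ β) / (1 - Cβ β) = √β / 2.581 := by
  have hs := Real.sqrt_pos.2 hβ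
  have hsq := Real.sq_sqrt hβ.le
  have h0 : β + Cβ β = √β * (1 + β) / (2.581 + √β) := by
    rw [Cβ, eq_div_iff (by positivity), add_mul, div_mul_cancel₀ _ (by positivity)]
    nlinarith
  rw [h0, one_sub_Cβ hβ]
  field_simp

theorem sigma_pos {β : ℝ} (hβ : 0 < β) (hβ' : β ≤ 0.15) (hν : 0 < ν) : 0 < sigma β ν := by
  have := Cβ_pos hβ hβ'
  have := Real.sqrt_pos.2 hν
  rw [sigma]
  positivity

theorem sigma_mul_sqrt {β : ℝ} (hν : 0 < ν) :
    sigma β ν * √ν = Cβ β / (1 + Cβ β) := by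
  have h2 := Real.sqrt_pos.2 hν
  rw [sigma, div_mul_eq_mul_div, mul_div_mul_right _ _ h2.ne']

/-- Here `ν ≥ 1` enters; it keeps the parameter positive under the decreasing update. -/
theorem sigma_lt_one {β : ℝ} (hβ : 0 < β) (hβ' : β ≤ 0.15) (hν : 1 ≤ ν) : sigma β ν < 1 := by
  have h1 := Cβ_pos hβ hβ'
  have h2 : 1 ≤ √ν := Real.one_le_sqrt.2 hν
  rw [sigma, div_lt_one (by positivity)]
  nlinarith

/-! ### Invariants of Phase II -/

/-- The warm start: closeness to the next central point after the parameter update. -/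
theorem warm_start (hnd : IsNondegenerate D f) {β : ℝ} (hβ : 0 < β)
    {a b x : E n} (ha : a ∈ D) (hb : b ∈ D) (hx : localNorm f a (x - a) ≤ β)
    (hab : localNorm f b (a - b) ≤ Cβ β) : localNorm f b (x - b) ≤ √β / 2.581 := by
  have hC1 := Cβ_lt_one hβ
  have h0 := localNorm_nonneg f b (a - b)
  have h1 := (hnd.localNorm_le_div hb ha (hab.trans_lt hC1) (x - a)).1
  have h2 := hnd.localNorm_add_le hb (x - a) (a - b)
  rw [sub_add_sub_cancel] at h2
  have h3 := localNorm_nonneg f b (x - a)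
  rw [← add_Cβ_div hβ, le_div_iff₀ (by linarith)]
  have h4 : (1 - Cβ β) * localNorm f b (x - a) ≤ β := by nlinarith
  nlinarith

theorem newton_step_bounds (hf : IsBarrier Ω D f ν)
    (hpos : ∀ x ∈ D, ∀ u : E n, u ≠ 0 → 0 < hess f x u u) (hν : 0 < ν)
    (hg : IsProperLscConvex g) {β t δ : ℝ} (hβ : 0 < β) (hβ' : β ≤ 0.15) (ht : 0 < t)
    {b x y : E n} (hb : IsCentralPoint D f g t b) (hx : x ∈ domF D g)
    (hy : IsDeltaSolution D f g t x δ y) (hδ0 : 0 ≤ δ) (hδ : δ ≤ 0.075 * β)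
    (hxb : localNorm f b (x - b) ≤ √β / 2.581) :
    localNorm f b (y - b) ≤ β ∧
      t⁻¹ * ((g y).toReal - (g b).toReal) ≤ psi β ν - ν := by
  have hnd := hf.nondegenerate hpos
  have hs := Real.sqrt_pos.2 hβ
  have hs' := sqrt_beta_le hβ'
  have hsq := Real.sq_sqrt hβ.le
  set s := √β with hsdef
  set l := localNorm f b (x - b) with hl
  have hl0 : 0 ≤ l := localNorm_nonneg _ _ _
  have hls : l ≤ 0.3875 * s := hxb.trans (by rw [div_le_iff₀ (by norm_num)]; nlinarith)
  have hl1 : l ≤ 0.1501 := by nlinarith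
  have hcmp := hnd.localNorm_le_div hb.1.1 hx.1 (by linarith : localNorm f b (x - b) < 1)
  have hρ := (hcmp (x - b)).2
  have hD1 := (hcmp (y - b)).1
  have hD2 := (hcmp (y - b)).2
  rw [localNorm_sub_comm f x x b] at hρ
  rw [← hl] at hρ hD1 hD2
  set ρ := localNorm f x (b - x) with hρdef
  have hρ0 : 0 ≤ ρ := localNorm_nonneg _ _ _
  have hρl : ρ ≤ 1.1767 * l := by nlinarith
  have hρ1 : ρ ≤ 0.17663 := by linarith
  obtain ⟨hN, hG⟩ := inexact_newton_step hf hpos hν hg ht hb hx hy (by linarith)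
  rw [← hρdef] at hN hG
  set d := localNorm f x (y - b) with hd
  set N := localNorm f b (y - b) with hNdef
  have hd0 : 0 ≤ d := localNorm_nonneg _ _ _
  have hN0 : 0 ≤ N := localNorm_nonneg _ _ _
  set e := ρ ^ 2 / (1 - ρ) with he
  have he0 : 0 ≤ e := div_nonneg (sq_nonneg _) (by linarith)
  have hl2 : l ^ 2 ≤ 0.150157 * β := by
    have := pow_le_pow_left₀ hl0 hls 2
    rw [mul_pow, hsq] at this
    norm_num at this ⊢
    linarith
  have hρ2 : ρ ^ 2 ≤ 0.208 * β := by
    have := pow_le_pow_left₀ hρ0 hρl 2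
    rw [mul_pow] at this
    norm_num at this hl2 ⊢
    linarith
  have he1 : e ≤ 0.2527 * β := by
    rw [he, div_le_iff₀ (by linarith)]
    nlinarith
  -- Solves `d² ≤ 2 e d + δ²` for `d`.
  have hde : d ≤ 2 * e + δ := by
    by_contra! hlt
    nlinarith [mul_lt_mul_of_pos_left hlt (by linarith : 0 < d)]
  have hNβ : N ≤ β := by
    have : (1 - l) * N ≤ (1 - l) * β := by nlinarith
    exact le_of_mul_le_mul_left this (by linarith)
  refine ⟨hNβ, ?_⟩
  -- In `psi`, `0.4 √β` is a rounded bound for `l`. Its `√ν` term covers `d`, its third term covers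
  -- `ρ²/2` with room to spare, and `0.003 β²` covers `δ²/2`.
  have hm : 0 < 1 - 0.4 * s := by linarith
  have hls' : 0 ≤ 0.4 * s - l := by linarith
  have hd' : d ≤ β / (1 - 0.4 * s) := by
    rw [le_div_iff₀ hm]
    linarith [mul_nonneg hd0 hls']
  have hρ' : ρ ≤ 0.4 * s / (1 - 0.4 * s) := by
    rw [le_div_iff₀ hm]
    linarith [mul_nonneg hρ0 hls']
  have h1 := mul_le_mul_of_nonneg_left hd' (Real.sqrt_nonneg ν)
  have h2 := pow_le_pow_left₀ hρ0 hρ' 2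
  rw [div_pow] at h2
  have h3 := pow_le_pow_left₀ hδ0 hδ 2
  have h4 : (0.4 * s) ^ 2 / (1 - 0.4 * s) ^ 2 ≤
      0.4 * s / (1 - 0.4 * s) ^ 2 * (1.075 * β + 0.4 * s) := by
    rw [div_mul_eq_mul_div]
    refine div_le_div_of_nonneg_right ?_ (sq_nonneg _)
    linarith [mul_pos hs hβ]
  have h5 : 0 ≤ (0.4 * s) ^ 2 / (1 - 0.4 * s) ^ 2 := by positivity
  rw [psi, ← hsdef]
  rw [mul_pow] at h3
  linarith [sq_nonneg β]

/-- The value of `ψ - ν` also covers a point whose barrier objective is within `ω(β)` of optimal. -/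
theorem initial_gap_le_psi {β : ℝ} (hβ : 0 < β) (hβ' : β ≤ 0.15) :
    omega β + √ν * β ≤ psi β ν - ν := by
  have hs := Real.sqrt_pos.2 hβ
  have hs' := sqrt_beta_le hβ'
  have hsq := Real.sq_sqrt hβ.le
  have hm : 0 < 1 - 0.4 * √β := by linarith
  have h1 : β ≤ β / (1 - 0.4 * √β) := by
    rw [le_div_iff₀ hm]
    nlinarith
  have h2 := mul_le_mul_of_nonneg_left h1 (Real.sqrt_nonneg ν)
  have h3 := omega_le_half_sq hβ.le
  have h4 : β ^ 2 / 2 ≤ 0.4 * √β / (1 - 0.4 * √β) ^ 2 * (1.075 * β + 0.4 * √β) := by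
    rw [div_mul_eq_mul_div, le_div_iff₀ (pow_pos hm 2)]
    have h5 : (1 - 0.4 * √β) ^ 2 ≤ 1 := pow_le_one₀ hm.le (by linarith)
    have h6 : β ^ 2 / 2 * (1 - 0.4 * √β) ^ 2 ≤ β ^ 2 / 2 :=
      mul_le_of_le_one_right (by positivity) h5
    nlinarith [mul_pos hs hβ]
  rw [psi]
  nlinarith [sq_nonneg β]

theorem phaseII_iteration (hf : IsBarrier Ω D f ν)
    (hpos : ∀ x ∈ D, ∀ u : E n, u ≠ 0 → 0 < hess f x u u) (hν : 1 ≤ ν)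
    (hg : IsProperLscConvex g) {β t t' δ : ℝ} (hβ : 0 < β) (hβ' : β ≤ 0.15) (ht : 0 < t)
    (htt : t' = (1 - sigma β ν) * t ∨ t' = (1 + sigma β ν) * t) {xc : ℝ → E n}
    (hxc : ∀ t : ℝ, 0 < t → IsCentralPoint D f g t (xc t)) {x y : E n} (hx : x ∈ domF D g)
    (hxβ : localNorm f (xc t) (x - xc t) ≤ β)
    (hy : IsDeltaSolution D f g t' x δ y) (hδ0 : 0 ≤ δ) (hδ : δ ≤ 0.075 * β) :
    0 < t' ∧ y ∈ domF D g ∧ localNorm f (xc t') (y - xc t') ≤ β ∧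
      (g y).toReal - (g (xc t')).toReal ≤ (psi β ν - ν) * t' := by
  have hν0 : 0 < ν := by linarith
  have hσ0 := sigma_pos hβ hβ' hν0
  have hσ1 := sigma_lt_one hβ hβ' hν
  have ht' : 0 < t' := by
    rcases htt with h | h <;> rw [h]
    · exact mul_pos (by linarith) ht
    · exact mul_pos (by linarith) ht
  have hdiff : |t' - t| ≤ sigma β ν * t := by
    have := mul_pos hσ0 ht
    rcases htt with h | h <;> rw [h, abs_le] <;> constructor <;> linarith
  have hd := central_path_dist hf hpos hν0 hg ht ht' hdiff (hxc t ht) (hxc t' ht')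
    (Cβ_pos hβ hβ').le (sigma_mul_sqrt hν0).le
  have hw := warm_start (hf.nondegenerate hpos) hβ (hxc t ht).1.1 (hxc t' ht').1.1 hxβ hd
  obtain ⟨h1, h2⟩ := newton_step_bounds hf hpos hν0 hg hβ hβ' ht' (hxc t' ht') hx hy hδ0 hδ hw
  refine ⟨ht', hy.1, h1, ?_⟩
  rwa [inv_mul_le_iff₀ ht', mul_comm t'] at h2

theorem psi_pos {β : ℝ} (hβ : 0 < β) (hβ' : β ≤ 0.15) (hν : 0 < ν) : 0 < psi β ν := by
  have hs := Real.sqrt_pos.2 hβ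
  have hm : 0 < 1 - 0.4 * √β := by linarith [sqrt_beta_le hβ']
  have := Real.sqrt_pos.2 hν
  rw [psi]
  positivity

end ProxPath

/-! ### Main theorem: invariant, error bound and iteration count. -/

theorem theorem5p2 (β : ℝ) (hβ : 0 < β) (hβ' : β ≤ 0.15) :
    ∃ K : ℝ, 0 < K ∧
      ∀ (n : ℕ) (_ : 0 < n)
        -- the problem data: the barrier `f` with `dom f = D`, the set `Ω` and the objective `g`
        (Ω D : Set (ProxPath.E n)) (f : ProxPath.E n → ℝ) (ν : ℝ) (g : ProxPath.E n → EReal)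
        (_ : 0 < ν) (_ : ProxPath.IsBarrier Ω D f ν)
        (_ : ∀ x ∈ D, ∀ u : ProxPath.E n, u ≠ 0 → 0 < ProxPath.hess f x u u)
        (_ : ProxPath.IsProperLscConvex g)
        -- the solutions `xc t` of the barrier problems and a solution `xs` of the constrained one
        (xc : ℝ → ProxPath.E n) (_ : ∀ t : ℝ, 0 < t → ProxPath.IsCentralPoint D f g t (xc t))
        (xs : ProxPath.E n) (_ : ProxPath.IsConstrainedSolution Ω g xs)
        -- the input of the algorithm
        (t₀ κ γ₀ : ℝ) (x₀ : ProxPath.E n)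
        (_ : 0 < t₀) (_ : 0 < κ) (_ : κ < 1) (_ : x₀ ∈ ProxPath.domF D g)
        (_ : 0 < γ₀) (_ : ProxPath.F f g t₀ x₀ - ProxPath.F f g t₀ (xc t₀) ≤ γ₀)
        -- `kbar` iterations of Phase II
        (kbar : ℕ) (t : ℕ → ℝ) (x : ℕ → ProxPath.E n)
        (_ : t 0 = t₀)
        -- the initial point comes from Phase I, or is any point close enough to `xc t₀`
        (_ : ProxPath.IsPhaseIOutput D f g β κ γ₀ t₀ x₀ (x 0) ∨
          (1 ≤ kbar ∧ x 0 ∈ ProxPath.domF D g ∧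
            ProxPath.localNorm f (xc t₀) (x 0 - xc t₀) ≤ β))
        (_ : ProxPath.IsPhaseIIRun D f g β ν kbar t x),
        -- both objective values are finite, and the error bound holds
        (g (x kbar) ≠ ⊤ ∧ g xs ≠ ⊤ ∧
          |(g (x kbar)).toReal - (g xs).toReal| ≤ ProxPath.psi β ν * t kbar) ∧
        -- the iteration count, for the decreasing update rule
        ((∀ k < kbar, t (k + 1) = (1 - ProxPath.sigma β ν) * t k) →
          ∀ ε : ℝ, 0 < ε →
            ⌈K * (√ν * Real.log (t₀ * ProxPath.psi β ν / ε))⌉₊ ≤ kbar →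
              |(g (x kbar)).toReal - (g xs).toReal| ≤ ε) := by
  open ProxPath in
  have hC := Cβ_pos hβ hβ'
  -- `K = 1 / (σ_β √ν)`, from which `ν` cancels.
  refine ⟨(1 + Cβ β) / Cβ β, by positivity, ?_⟩
  intro n hn Ω D f ν g hν hf hpos hg xc hxc xs hxs t₀ κ γ₀ x₀ ht₀ hκ0 hκ1 hx₀ _ hγ kbar t x htz
    hinit hrun
  have hnd := hf.nondegenerate hpos
  have hν1 := hf.one_le hpos hν hn
  have hσ0 := sigma_pos (ν := ν) hβ hβ' hν
  have hσ1 := sigma_lt_one hβ hβ' hν1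
  have hψ := psi_pos hβ hβ' hν
  -- Closeness alone does not supply the objective gap. With no Phase II step it comes from the
  -- Phase I value gap; otherwise the last Newton step supplies it, so it is tracked only at `k =
  -- kbar`.
  have hstart : x 0 ∈ domF D g ∧ localNorm f (xc t₀) (x 0 - xc t₀) ≤ β ∧
      (kbar = 0 → (g (x 0)).toReal - (g (xc t₀)).toReal ≤ (psi β ν - ν) * t₀) := by
    rcases hinit with h | ⟨hk, h1, h2⟩
    · have hc := hxc t₀ ht₀
      obtain ⟨h1, h2⟩ := h.gap_le hnd hg ht₀ hκ0 hκ1 hx₀ hγ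
      have h3 := hc.omega_add_le hnd hg ht₀ h1
      have h4 := omega_le_omega_iff (localNorm_nonneg _ _ _) hβ.le (h3.trans h2)
      refine ⟨h1, h4, fun _ => ?_⟩
      have h5 := (abs_le.1 (hf.abs_grad_le hpos hν hc.1.1 (x 0 - xc t₀))).1
      have h6 := mul_le_mul_of_nonneg_left h4 (Real.sqrt_nonneg ν)
      have h7 := hnd.value_lower hc.1.1 h1.1
      have h8 : 0 ≤ omega (localNorm f (xc t₀) (x 0 - xc t₀)) := by
        have := Real.log_le_sub_one_of_pos
          (by linarith [localNorm_nonneg f (xc t₀) (x 0 - xc t₀)] :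
            0 < 1 + localNorm f (xc t₀) (x 0 - xc t₀))
        rw [omega]
        linarith
      have h9 := initial_gap_le_psi (ν := ν) hβ hβ'
      have h10 : t₀⁻¹ * ((g (x 0)).toReal - (g (xc t₀)).toReal) ≤ psi β ν - ν := by
        simp only [F] at h2
        linarith
      rwa [inv_mul_le_iff₀ ht₀, mul_comm t₀] at h10
    · exact ⟨h1, h2, fun h => by omega⟩
  have key : ∀ k ≤ kbar, 0 < t k ∧ x k ∈ domF D g ∧
      localNorm f (xc (t k)) (x k - xc (t k)) ≤ β ∧
      (k = kbar → (g (x k)).toReal - (g (xc (t k))).toReal ≤ (psi β ν - ν) * t k) := by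
    intro k
    induction k with
    | zero =>
      intro _
      rw [htz]
      exact ⟨ht₀, hstart.1, hstart.2.1, fun h => hstart.2.2 h.symm⟩
    | succ k ih =>
      intro hk
      obtain ⟨h1, h2, h3, -⟩ := ih (by omega)
      obtain ⟨htt, δ, hδ0, hδ, hy⟩ := hrun k (by omega)
      obtain ⟨k1, k2, k3, k4⟩ := phaseII_iteration hf hpos hν1 hg hβ hβ' h1 htt hxc h2 h3 hy hδ0 hδ
      exact ⟨k1, k2, k3, fun _ => k4⟩
  obtain ⟨htk, hxk, -, hgap⟩ := key kbar le_rfl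
  have hle : g xs ≤ g (x kbar) := hxs.2 _ (hf.closure_eq ▸ subset_closure hxk.1)
  have hxsT : g xs ≠ ⊤ := ne_top_of_le_ne_top hxk.2 hle
  have hle' : (g xs).toReal ≤ (g (x kbar)).toReal :=
    EReal.toReal_le_toReal hle (hg.ne_bot _) hxk.2
  have hcen := hf.central_gap_le hpos hν hg htk (hxc _ htk) hxs.1 hxsT
  have hbound : |(g (x kbar)).toReal - (g xs).toReal| ≤ psi β ν * t kbar := by
    rw [abs_of_nonneg (sub_nonneg.2 hle')]
    linarith [hgap rfl]
  refine ⟨⟨hxk.2, hxsT, hbound⟩, fun hdec ε hε hk => hbound.trans ?_⟩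
  have htpow : ∀ k ≤ kbar, t k = (1 - sigma β ν) ^ k * t₀ := by
    intro k
    induction k with
    | zero => intro _; simp [htz]
    | succ k ih =>
      intro hk
      rw [hdec k (by omega), ih (by omega), pow_succ]
      ring
  have hpow : (1 - sigma β ν) ^ kbar ≤ Real.exp (-(kbar * sigma β ν)) := by
    have := pow_le_pow_left₀ (by linarith) (Real.one_sub_le_exp_neg (sigma β ν)) kbar
    rwa [← Real.exp_nat_mul, mul_neg] at this
  have hlog : Real.log (t₀ * psi β ν / ε) ≤ kbar * sigma β ν := by
    -- `⌈·⌉₊` vanishes on negative reals, which accounts for the maximum with 0.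
    have h1 := mul_le_mul_of_nonneg_right (Nat.ceil_le.1 hk) hσ0.le
    have h2 : (1 + Cβ β) / Cβ β * (√ν * Real.log (t₀ * psi β ν / ε)) * sigma β ν =
        (1 + Cβ β) / Cβ β * (sigma β ν * √ν) * Real.log (t₀ * psi β ν / ε) := by ring
    rw [h2, sigma_mul_sqrt hν, div_mul_div_cancel₀ hC.ne', div_self (by positivity), one_mul] at h1
    exact h1
  have hexp : Real.exp (-(kbar * sigma β ν)) ≤ ε / (t₀ * psi β ν) := by
    have hp : 0 < t₀ * psi β ν / ε := by positivity
    calc Real.exp (-(kbar * sigma β ν)) ≤ Real.exp (-Real.log (t₀ * psi β ν / ε)) :=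
          Real.exp_le_exp.2 (by linarith)
      _ = ε / (t₀ * psi β ν) := by rw [Real.exp_neg, Real.exp_log hp, inv_div]
  rw [htpow kbar le_rfl]
  have h1 : (1 - sigma β ν) ^ kbar * (t₀ * psi β ν) ≤ ε :=
    (le_div_iff₀ (by positivity)).1 (hpow.trans hexp)
  linarith
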